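/- **Problem.** Let $\lambda>0$, $f:\mathbb R^n\to\mathbb R$ twice continuously differentiable, $\varphi(x)=f(x)+\lambda\|x\|_1$, and consider $\min_x\varphi(x)$. Norms are Euclidean, $\mathbb B(x,r)$ is the open ball. For an index set $I$, $x_I$ and $A_I$ denote subvector and principal submatrix. For $0<\varepsilon_g<1$ and $x\in\mathbb R^n$ let $I_+^\varepsilon(x)=\{i: x_i>\varepsilon_g^{1/2}\}$, $I_-^\varepsilon(x)=\{i: x_i<-\varepsilon_g^{1/2}\}$, $I_0^\varepsilon(x)=\{i:|x_i|\le\varepsilon_g^{1/2}\}$, $I_{\ne0}^\varepsilon=I_+^\varepsilon\cup I_-^\varepsilon$, $I_{\ne 0}(x)=\{i:x_i\ne0\}$, and let $g^\varepsilon(x)\in\mathbb R^n$ have the components $\nabla_if(x)+\lambda$ if $i\in I_+^\varepsilon(x)$, $\nabla_if(x)-\lambda$ if $i\in I_-^\varepsilon(x)$, and $\nabla_if(x)-\min\{\max\{-\lambda-\varepsilon_g^{3/4},\nabla_if(x)\},\lambda+\varepsilon_g^{3/4}\}$ if $i\in I_0^\varepsilon(x)$. Put $\mathcal S^*=\{x: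 g^\varepsilon(x)=0,\ (\nabla^2f(x))_{I_{\ne0}(x)}\succeq0\}$. **Algorithm FPGN2CM.** Parameters: $\varepsilon_g\in(0,1)$, $\beta>1$, $\delta\in[0,1]$, $\tau>1$, $\zeta\in(0,1)$, $\bar\eta\in(0,1)$, $\eta\in(0,\frac{1-\zeta}2)$, $\theta\in(0,1)$. From $x^k$, with $g^{k\varepsilon}=g^\varepsilon(x^k)$ and $I=I_{\ne0}^\varepsilon(x^k)$: 1. If $g^{k\varepsilon}_i\ne0$ for some $i\in I_0^\varepsilon(x^k)$ (proximal gradient step): for $t>0$ let $p_t=\mathrm{prox}_{\frac\lambda t\|\cdot\|_1}(x^k-\frac1t\nabla f(x^k))$, $G_t=t(x^k-p_t)$; set $x^{k+1}=p_t$ with $t=\beta^{j}$, $j\ge0$ the smallest integer with $\varphi(p_t)<\varphi(x^k)-\frac{\bar\eta}t\|G_t\|^2$. 2. Otherwise, if $g:=g^{k\varepsilon}_I\ne0$ (Newton-CG step): apply the Capped CG method below to $H=(\nabla^2f(x^k))_I$ and $g$, giving $(d,d_{\rm type})$. Set $d^k_i=0$ for $i\notin I$, and $d^k_I=d$ if $d_{\rm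 type}={\rm SOL}$, $d^k_I=-\mathrm{sgn}(d^\top g)\frac{|d^\top Hd|}{\|d\|^2}\frac d{\|d\|}$ if $d_{\rm type}={\rm NC}$ ($\mathrm{sgn}(0)=1$). Set $x^{k+1}=x^k+\theta^jd^k$, $j\ge0$ the smallest integer with $\varphi(x^k+\theta^jd^k)<\varphi(x^k)-\eta\theta^{2j}\varepsilon_g^{1/2}\|d^k\|^2$. 3. Otherwise $g^{k\varepsilon}=0$; the method stops, and we put $x^{k+1}=x^k$. **Capped CG method** with initial bound $M\ge0$ (arbitrary at each call), $\epsilon=\varepsilon_g^{1/2}$, regularization $\tau_k=\tau\varepsilon_g^{1/2}$. Let $\bar H=H+\tau\varepsilon_g^{1/2}\|g\|^\delta I$ and, always for the current $M$, $$\kappa^{cg}=\frac{M+\tau\varepsilon_g^{1/2}\|g\|^\delta}{\varepsilon_g^{1/2}\|g\|^\delta},\quad \hat\zeta=\frac\zeta{3\kappa^{cg}},\quad \tau^{cg}=\frac{\sqrt{\kappa^{cg}}}{\sqrt{\kappa^{cg}}+1},\quad T=\frac{4(\kappa^{cg})^4}{(1-\sqrt{\tau^{cg}})^2}.$$ "Updating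 $M$ by $v$" means: if $\|Hv\|>M\|v\|$, replace $M$ by $\|Hv\|/\|v\|$. Call $v$ *low* if $v^\top\bar Hv<\epsilon\|v\|^2$. Start with $y_0=0$, $r_0=g$, $p_0=-g$. If $p_0$ is low, return $(p_0,{\rm NC})$; else update $M$ by $p_0$. For $j=0,1,\dots$ let $\alpha_j=\frac{\|r_j\|^2}{p_j^\top\bar Hp_j}$, $y_{j+1}=y_j+\alpha_jp_j$, $r_{j+1}=r_j+\alpha_j\bar Hp_j$, $p_{j+1}=-r_{j+1}+\frac{\|r_{j+1}\|^2}{\|r_j\|^2}p_j$, update $M$ by $p_{j+1}$, $y_{j+1}$, $r_{j+1}$ in this order, increase $j$ by one, and test in this order: if $y_j$ is low return $(y_j,{\rm NC})$; if $\|r_j\|\le\hat\zeta\|r_0\|$ return $(y_j,{\rm SOL})$; if $p_j$ is low return $(p_j,{\rm NC})$; if $\|r_j\|>\sqrt T(\tau^{cg})^{j/2}\|r_0\|$ compute $y_{j+1}$, find $i<j$ with $y_{j+1}-y_i$ low and return $(y_{j+1}-y_i,{\rm NC})$. **Theorem.** Let $x^0\in\mathbb R^n$ be such that $\{\varphi\le\varphi(x^0)\}$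 is bounded and $\nabla^2f$ is Lipschitz continuous on an open neighbourhood of it. Let $f$ be convex, let $x^*$ be a minimizer of $\varphi$ with $\nabla^2f(x^*)\succ\mu I$, $\mu>0$, and let $\varepsilon_g\le\frac14\mu^2$. Let $\kappa>0$, $0<b_1<1$ be such that $$\kappa\,\mathrm{dist}(x,\mathcal S^*)\le\|g^\varepsilon(x)\|\qquad\text{for all }x\in\mathbb B(x^*,b_1).$$ Then there are constants $C>0$ and $\rho\in(0,1)$, and for every $b>0$ there is $r>0$, such that the following holds for every sequence $\{x^k\}$ generated by FPGN2CM from $x^0$ that satisfies: whenever $x^k\in\mathbb B(x^*,b_1)$ and $\bar x\in\mathcal S^*$ with $\|x^k-\bar x\|=\mathrm{dist}(x^k,\mathcal S^*)$, one has $I_\pm^\varepsilon(\bar x)=I_\pm^\varepsilon(x^k)$. If $K$ is such that no proximal gradient step is taken at any $k\ge K$, and $x^K\in\mathbb B(x^*,r)$, then (i) $\mathrm{dist}(x^k,\mathcal S^*)\to0$ with rate $1+\delta$: $\mathrm{dist}(x^{k+1},\mathcal S^*)\le C\,\mathrm{dist}(x^k,\mathcal S^*)^{1+\delta}$ for all $k\ge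 K$, and at least linearly: $\mathrm{dist}(x^{K+m},\mathcal S^*)\le C\rho^m\,\mathrm{dist}(x^K,\mathcal S^*)$ for all $m\ge0$; (ii) $\{x^k\}$ converges to a point $\hat x\in\mathcal S^*\cap\mathbb B(x^*,b)$. -/

import Mathlib

open Topology Filter

noncomputable section

namespace L1Newton

/-! ### The problem `min f x + lam * ‖x‖₁` on `ℝⁿ` -/

/-- `ℝⁿ` with the Euclidean norm. -/
abbrev Vec (n : ℕ) := EuclideanSpace ℝ (Fin n)

variable {n : ℕ}

/-- The `ℓ₁` norm. -/
def l1norm (x : Vec n) : ℝ := ∑ i, |x i|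

/-- The objective `φ = f + lam ‖·‖₁`. -/
def objective (f : Vec n → ℝ) (lam : ℝ) (x : Vec n) : ℝ := f x + lam * l1norm x

/-- The Hessian matrix of `f`. -/
def hess (f : Vec n → ℝ) (x : Vec n) : Matrix (Fin n) (Fin n) ℝ :=
  Matrix.of fun i j => (fderiv ℝ (gradient f) x (EuclideanSpace.single j 1)) i

/-- The level set of the objective at `x0` is bounded, and `f` is twice continuously differentiable
with uniformly Lipschitz Hessian on an open neighbourhood of it. -/
structure LevelSetAssumption (f : Vec n → ℝ) (lam : ℝ) (x0 : Vec n) : Prop where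
  bounded : Bornology.IsBounded {x | objective f lam x ≤ objective f lam x0}
  smooth : ∃ U : Set (Vec n), IsOpen U ∧ {x | objective f lam x ≤ objective f lam x0} ⊆ U ∧
    ContDiffOn ℝ 2 f U ∧ ∃ L : NNReal, LipschitzOnWith L (fderiv ℝ (gradient f)) U

/-! ### Index sets, subvectors, principal submatrices -/

/-- `I₊^ε = {i | x_i > ε^{1/2}}`. -/
def IPos (eps : ℝ) (x : Vec n) : Finset (Fin n) := {i | √eps < x i}

/-- `I₋^ε = {i | x_i < -ε^{1/2}}`. -/
def INeg (eps : ℝ) (x : Vec n) : Finset (Fin n) := {i | x i < -√eps}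

/-- `I₀^ε = {i | |x_i| ≤ ε^{1/2}}`. -/
def IZero (eps : ℝ) (x : Vec n) : Finset (Fin n) := {i | |x i| ≤ √eps}

/-- `I_{≠0}^ε = I₊^ε ∪ I₋^ε`. -/
def INonzero (eps : ℝ) (x : Vec n) : Finset (Fin n) := IPos eps x ∪ INeg eps x

/-- `I_{≠0} = {i | x_i ≠ 0}`. -/
def supp (x : Vec n) : Finset (Fin n) := {i | x i ≠ 0}

/-- The subvector `x_I`. -/
def subvec (I : Finset (Fin n)) (x : Vec n) : EuclideanSpace ℝ I :=
  WithLp.toLp 2 fun i => x i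

/-- The vector of `ℝⁿ` that equals `d` on `I` and vanishes off `I`. -/
def extend (I : Finset (Fin n)) (d : EuclideanSpace ℝ I) : Vec n :=
  WithLp.toLp 2 fun i => if h : i ∈ I then d ⟨i, h⟩ else 0

/-- The principal submatrix `A_I`. -/
def subMat (I : Finset (Fin n)) (A : Matrix (Fin n) (Fin n) ℝ) : Matrix I I ℝ :=
  A.submatrix Subtype.val Subtype.val

/-! ### Approximate stationarity -/

/-- The vector `g^ε(x)`. -/
def gEps (f : Vec n → ℝ) (lam eps : ℝ) (x : Vec n) : Vec n :=
  WithLp.toLp 2 fun i =>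
    if √eps < x i then gradient f x i + lam
    else if x i < -√eps then gradient f x i - lam
    else gradient f x i -
      min (max (-lam - eps ^ (3 / 4 : ℝ)) (gradient f x i)) (lam + eps ^ (3 / 4 : ℝ))

/-- `S* = {x | g^ε(x) = 0, (∇²f(x))_{I≠0} ⪰ 0}`. -/
def SStar (f : Vec n → ℝ) (lam eps : ℝ) : Set (Vec n) :=
  {x | gEps f lam eps x = 0 ∧ (subMat (supp x) (hess f x)).PosSemidef}

/-- The error bound of exponent `q` at `xs`, with constant `kappa`, on the ball of radius `b1`. -/
def ErrorBound (f : Vec n → ℝ) (lam eps q kappa b1 : ℝ) (xs : Vec n) : Prop :=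
  ∀ x ∈ Metric.ball xs b1,
    kappa * Metric.infDist x (SStar f lam eps) ≤ ‖gEps f lam eps x‖ ^ q

/-- For each iterate in the ball of radius `b1` about `xs`, every nearest point of `S*` has the same
index sets `I₊^ε`, `I₋^ε` as the iterate. -/
def SignPatternAssumption (f : Vec n → ℝ) (lam eps b1 : ℝ) (xs : Vec n) (x : ℕ → Vec n) : Prop :=
  ∀ k, x k ∈ Metric.ball xs b1 → ∀ xbar ∈ SStar f lam eps,
    ‖x k - xbar‖ = Metric.infDist (x k) (SStar f lam eps) →
      IPos eps xbar = IPos eps (x k) ∧ INeg eps xbar = INeg eps (x k)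

/-! ### The Capped CG method -/

section CappedCG

variable {V : Type*} [NormedAddCommGroup V] [InnerProductSpace ℝ V]

/-- The variables `y_j, r_j, p_j, M` of the Capped CG method. -/
structure CGState (V : Type*) where
  y : V
  r : V
  p : V
  M : ℝ

/-- The type of an output of the Capped CG method. -/
inductive CGType
  | SOL
  | NC

/-- The inputs of the Capped CG method: the operator `H`, the vector `g`, the curvature threshold
`eps`, the accuracy `zeta`, the exponent `delta` and the regularization factor `tau`. -/
structure CGData (V : Type*) [NormedAddCommGroup V] [InnerProductSpace ℝ V] where
  H : V →ₗ[ℝ] V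
  g : V
  eps : ℝ
  zeta : ℝ
  delta : ℝ
  tau : ℝ

namespace CGData

/-- `H̄ v = H v + tau ‖g‖^delta v`. -/
def Hbar (D : CGData V) (v : V) : V := D.H v + (D.tau * ‖D.g‖ ^ D.delta) • v

/-- The constant `κ^cg` for the current bound `M`. -/
def kcg (D : CGData V) (M : ℝ) : ℝ :=
  (M + D.tau * ‖D.g‖ ^ D.delta) / (D.eps * ‖D.g‖ ^ D.delta)

/-- The relative accuracy `ζ̂`. -/
def zetaHat (D : CGData V) (M : ℝ) : ℝ := D.zeta / (3 * D.kcg M)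

/-- The contraction factor `τ` of the method. -/
def rate (D : CGData V) (M : ℝ) : ℝ := √(D.kcg M) / (√(D.kcg M) + 1)

/-- The constant `T`. -/
def bigT (D : CGData V) (M : ℝ) : ℝ := 4 * D.kcg M ^ 4 / (1 - √(D.rate M)) ^ 2

/-- `v` has curvature less than `eps` for `H̄`. -/
def LowCurv (D : CGData V) (v : V) : Prop := inner ℝ v (D.Hbar v) < D.eps * ‖v‖ ^ 2

open Classical in
/-- The update of `M` by the vector `v`. -/
def bump (D : CGData V) (M : ℝ) (v : V) : ℝ :=
  if M * ‖v‖ < ‖D.H v‖ then ‖D.H v‖ / ‖v‖ else M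

/-- The state at the entry of the main loop, from the initial bound `M0`. -/
def init (D : CGData V) (M0 : ℝ) : CGState V where
  y := 0
  r := D.g
  p := -D.g
  M := D.bump M0 (-D.g)

/-- One pass through the update part of the main loop. -/
def step (D : CGData V) (s : CGState V) : CGState V :=
  let a : ℝ := inner ℝ s.r s.r / inner ℝ s.p (D.Hbar s.p)
  let y' : V := s.y + a • s.p
  let r' : V := s.r + a • D.Hbar s.p
  let b : ℝ := inner ℝ r' r' / inner ℝ s.r s.r
  let p' : V := -r' + b • s.p
  { y := y', r := r', p := p', M := D.bump (D.bump (D.bump s.M p') y') r' }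

/-- The state with index `j`. -/
def state (D : CGData V) (M0 : ℝ) (j : ℕ) : CGState V := D.step^[j] (D.init M0)

/-- The second termination test at index `j`: the residual is small. -/
def SmallRes (D : CGData V) (M0 : ℝ) (j : ℕ) : Prop :=
  ‖(D.state M0 j).r‖ ≤ D.zetaHat (D.state M0 j).M * ‖D.g‖

/-- The last termination test at index `j`: the residual decays too slowly. -/
def SlowRes (D : CGData V) (M0 : ℝ) (j : ℕ) : Prop :=
  √(D.bigT (D.state M0 j).M) * D.rate (D.state M0 j).M ^ ((j : ℝ) / 2) * ‖D.g‖ <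
    ‖(D.state M0 j).r‖

/-- No termination test succeeds at index `j`. -/
def Continues (D : CGData V) (M0 : ℝ) (j : ℕ) : Prop :=
  ¬ D.LowCurv (D.state M0 j).y ∧ ¬ D.SmallRes M0 j ∧ ¬ D.LowCurv (D.state M0 j).p ∧
    ¬ D.SlowRes M0 j

/-- The method terminates at index `j` with output `(d, ty)`; the tests are tried in order. -/
def StopsAt (D : CGData V) (M0 : ℝ) (j : ℕ) (d : V) (ty : CGType) : Prop :=
  (D.LowCurv (D.state M0 j).y ∧ d = (D.state M0 j).y ∧ ty = CGType.NC) ∨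
  (¬ D.LowCurv (D.state M0 j).y ∧ D.SmallRes M0 j ∧ d = (D.state M0 j).y ∧ ty = CGType.SOL) ∨
  (¬ D.LowCurv (D.state M0 j).y ∧ ¬ D.SmallRes M0 j ∧ D.LowCurv (D.state M0 j).p ∧
    d = (D.state M0 j).p ∧ ty = CGType.NC) ∨
  (¬ D.LowCurv (D.state M0 j).y ∧ ¬ D.SmallRes M0 j ∧ ¬ D.LowCurv (D.state M0 j).p ∧
    D.SlowRes M0 j ∧ ty = CGType.NC ∧
    ∃ i < j, D.LowCurv ((D.state M0 (j + 1)).y - (D.state M0 i).y) ∧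
      d = (D.state M0 (j + 1)).y - (D.state M0 i).y)

/-- `(d, ty)` is an output of the Capped CG method started with the bound `M0`. -/
def Output (D : CGData V) (M0 : ℝ) (d : V) (ty : CGType) : Prop :=
  (D.LowCurv (-D.g) ∧ d = -D.g ∧ ty = CGType.NC) ∨
  (¬ D.LowCurv (-D.g) ∧ ∃ j, 1 ≤ j ∧ (∀ i, 1 ≤ i → i < j → D.Continues M0 i) ∧
    D.StopsAt M0 j d ty)

end CGData

end CappedCG

/-! ### The method FPGN2CM -/

/-- The parameters of the method, with their admissible ranges. -/
structure Params where
  epsg : ℝ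
  beta : ℝ
  delta : ℝ
  tau : ℝ
  zeta : ℝ
  etabar : ℝ
  eta : ℝ
  theta : ℝ
  epsg_pos : 0 < epsg
  epsg_lt : epsg < 1
  beta_gt : 1 < beta
  delta_nonneg : 0 ≤ delta
  delta_le : delta ≤ 1
  tau_gt : 1 < tau
  zeta_pos : 0 < zeta
  zeta_lt : zeta < 1
  etabar_pos : 0 < etabar
  etabar_lt : etabar < 1
  eta_pos : 0 < eta
  eta_lt : eta < (1 - zeta) / 2
  theta_pos : 0 < theta
  theta_lt : theta < 1

/-- `p = prox_h(z)`, the minimizer of `h + ‖· - z‖² / 2`. -/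
def IsProx (h : Vec n → ℝ) (z p : Vec n) : Prop :=
  ∀ y, h p + ‖p - z‖ ^ 2 / 2 ≤ h y + ‖y - z‖ ^ 2 / 2

/-- `p` is the proximal gradient point of `x` for the parameter `t`, and it gives sufficient
decrease; `t • (x - p)` is the gradient mapping `G_t(x)`. -/
def ProxAccepted (f : Vec n → ℝ) (lam etabar t : ℝ) (x p : Vec n) : Prop :=
  IsProx (fun y => lam / t * l1norm y) (x - (1 / t) • gradient f x) p ∧
    objective f lam p < objective f lam x - etabar / t * ‖t • (x - p)‖ ^ 2

/-- The proximal gradient step from `x` to `x'` with backtracking. -/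
def ProxStep (f : Vec n → ℝ) (lam : ℝ) (P : Params) (x x' : Vec n) : Prop :=
  ∃ j : ℕ, ProxAccepted f lam P.etabar (P.beta ^ j) x x' ∧
    ∀ i < j, ∀ p, ¬ ProxAccepted f lam P.etabar (P.beta ^ i) x p

/-- The sign function with `sgn 0 = 1`. -/
def sgn (t : ℝ) : ℝ := if 0 ≤ t then 1 else -1

/-- The data of the Capped CG call at `x`: the regularized Newton equation on `I_{≠0}^ε` with
`τ_k = tau * ε_g^{1/2}` and curvature threshold `ε_h = ε_g^{1/2}`. -/
def newtonData (f : Vec n → ℝ) (lam : ℝ) (P : Params) (x : Vec n) :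
    CGData (EuclideanSpace ℝ (INonzero P.epsg x)) where
  H := Matrix.toEuclideanLin (subMat (INonzero P.epsg x) (hess f x))
  g := subvec (INonzero P.epsg x) (gEps f lam P.epsg x)
  eps := √P.epsg
  zeta := P.zeta
  delta := P.delta
  tau := P.tau * √P.epsg

/-- The direction on `I_{≠0}^ε` obtained from the output `(d, ty)` of the Capped CG method. -/
def newtonDir {V : Type*} [NormedAddCommGroup V] [InnerProductSpace ℝ V] (D : CGData V) (d : V) :
    CGType → V
  | CGType.SOL => d
  | CGType.NC => (-(sgn (inner ℝ d D.g)) * (|inner ℝ d (D.H d)| / ‖d‖ ^ 2)) • ((1 / ‖d‖) • d)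

/-- The line search condition of the Newton-CG step for the step size `t`. -/
def NewtonAccepted (f : Vec n → ℝ) (lam : ℝ) (P : Params) (t : ℝ) (x d : Vec n) : Prop :=
  objective f lam (x + t • d) < objective f lam x - P.eta * t ^ 2 * √P.epsg * ‖d‖ ^ 2

/-- The Newton-CG step from `x` to `x'`. -/
def NewtonStep (f : Vec n → ℝ) (lam : ℝ) (P : Params) (x x' : Vec n) : Prop :=
  ∃ (M0 : ℝ) (d : EuclideanSpace ℝ (INonzero P.epsg x)) (ty : CGType),
    0 ≤ M0 ∧ (newtonData f lam P x).Output M0 d ty ∧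
    ∃ dk : Vec n, dk = extend (INonzero P.epsg x) (newtonDir (newtonData f lam P x) d ty) ∧
    ∃ j : ℕ, NewtonAccepted f lam P (P.theta ^ j) x dk ∧
      (∀ i < j, ¬ NewtonAccepted f lam P (P.theta ^ i) x dk) ∧
      x' = x + P.theta ^ j • dk

/-- The proximal gradient step is invoked at `x`. -/
def ProxInvoked (f : Vec n → ℝ) (lam : ℝ) (P : Params) (x : Vec n) : Prop :=
  ∃ i ∈ IZero P.epsg x, gEps f lam P.epsg x i ≠ 0

/-- The Newton-CG step is invoked at `x`. -/
def NewtonInvoked (f : Vec n → ℝ) (lam : ℝ) (P : Params) (x : Vec n) : Prop :=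
  ¬ ProxInvoked f lam P x ∧ ∃ i ∈ INonzero P.epsg x, gEps f lam P.epsg x i ≠ 0

/-- The sequence `x` is generated by FPGN2CM. When no step is invoked at `x k`, that is, when
`g^ε(x k) = 0`, the method has nothing left to do and the sequence is continued by `x k`. -/
def Generated (f : Vec n → ℝ) (lam : ℝ) (P : Params) (x : ℕ → Vec n) : Prop :=
  ∀ k,
    (ProxInvoked f lam P (x k) → ProxStep f lam P (x k) (x (k + 1))) ∧
    (NewtonInvoked f lam P (x k) → NewtonStep f lam P (x k) (x (k + 1))) ∧
    (¬ ProxInvoked f lam P (x k) → ¬ NewtonInvoked f lam P (x k) → x (k + 1) = x k)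

end L1Newton

end

open Topology Filter

noncomputable section

namespace L1Newton

/-! Write `e = √ε_g`. Since `2e ≤ mu`, the Hessian has curvature at least `3e/2` on a ball around
`xs`. There the Capped CG method never meets low curvature, whatever its initial bound, and returns
an inexact solution `d` of the regularized Newton equation (`CGData.direction_estimates`). Near `xs`
the residual is so small that `d` changes no sign and the full step is accepted (`newtonStep_full`).

As no proximal step follows, the new `g^ε` is carried by `I_{≠0}^ε` of the old point and equals the
linearized residual there up to a Taylor remainder. Hence `‖g^ε‖` contracts with order `1 + δ`, and
also by the factor `(tau + 1)/(tau + 3/2)` (`step_estimate`); the second bound is what gives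
convergence when `δ = 0`.

The error bound and the preserved sign pattern make `‖g^ε‖` comparable to the distance to `S*`, so
both rates pass to the distance. Step lengths are at most `‖g^ε‖ / e`, so the iterates stay in the
ball and form a Cauchy sequence (`geometric_trapping`). Positive curvature makes `S*` locally the
closed set `g^ε = 0`, so the limit lies in it. -/

lemma contraction_factor {e tau σ z g r d h : ℝ} (he : 0 < e) (htau : 1 < tau) (hσ : 0 ≤ σ)
    (hg : 0 ≤ g) (hr0 : 0 ≤ r) (hh : h ≤ r + σ * d) (hd : (3 / 2 * e + σ) * d ≤ g + r)
    (hr : r ≤ z * g) (hz : z * (3 / 2 * e + σ) ≤ e / 3) (hσe : σ ≤ tau * e) :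
    h ≤ (tau + 2 / 3) / (tau + 3 / 2) * g := by
  have hb : 0 < 3 / 2 * e + σ := by positivity
  -- The letters stand for norms: `h` for the unregularized residual, `r` for the CG residual.
  -- Without `r` the factor would be `σ / (σ + 3e/2)`; each of the two occurrences of `r` adds `e/3`
  -- to the numerator. The quotient increases in `σ`, so `σ = tau * e` is the worst case.
  have h1 : (3 / 2 * e + σ) * r ≤ e / 3 * g := by
    calc (3 / 2 * e + σ) * r ≤ (3 / 2 * e + σ) * (z * g) := by gcongr
      _ = z * (3 / 2 * e + σ) * g := by ring
      _ ≤ _ := by gcongr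
  have h2 : σ * r ≤ e / 3 * g := by
    have := mul_nonneg he.le hr0
    linarith
  have h3 : σ * ((3 / 2 * e + σ) * d) ≤ σ * (g + r) := by gcongr
  have h4 : (3 / 2 * e + σ) * h ≤ (3 / 2 * e + σ) * (r + σ * d) := by gcongr
  have h5 : (3 / 2 * e + σ) * h ≤ (σ + 2 / 3 * e) * g := by linarith
  have h6 : (σ + 2 / 3 * e) * (tau + 3 / 2) ≤ (tau + 2 / 3) * (3 / 2 * e + σ) := by
    linarith
  have ht : 0 < tau + 3 / 2 := by linarith
  rw [div_mul_eq_mul_div, le_div_iff₀ ht]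
  refine le_of_mul_le_mul_left ?_ hb
  calc (3 / 2 * e + σ) * (h * (tau + 3 / 2)) = ((3 / 2 * e + σ) * h) * (tau + 3 / 2) := by ring
    _ ≤ (σ + 2 / 3 * e) * g * (tau + 3 / 2) := by gcongr
    _ = (σ + 2 / 3 * e) * (tau + 3 / 2) * g := by ring
    _ ≤ (tau + 2 / 3) * (3 / 2 * e + σ) * g := by gcongr
    _ = _ := by ring

/-! ### The Capped CG method for a coercive operator -/

namespace CGData

variable {V : Type*} [NormedAddCommGroup V] [InnerProductSpace ℝ V] (D : CGData V)

lemma Hbar_add (u v : V) : D.Hbar (u + v) = D.Hbar u + D.Hbar v := by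
  simp only [Hbar, map_add, smul_add]; abel

lemma Hbar_smul (a : ℝ) (v : V) : D.Hbar (a • v) = a • D.Hbar v := by
  simp only [Hbar, map_smul, smul_add]
  rw [smul_comm]

lemma le_bump (M : ℝ) (v : V) : M ≤ D.bump M v := by
  unfold bump
  split_ifs with h
  · rcases eq_or_ne v 0 with rfl | hv
    · simp at h
    · rw [le_div_iff₀ (norm_pos_iff.mpr hv)]; exact h.le
  · exact le_rfl

lemma norm_H_le_bump (M : ℝ) (v : V) : ‖D.H v‖ ≤ D.bump M v * ‖v‖ := by
  unfold bump
  split_ifs with h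
  · rcases eq_or_ne v 0 with rfl | hv
    · simp
    · rw [div_mul_cancel₀ _ (norm_ne_zero_iff.mpr hv)]
  · exact not_lt.mp h

lemma state_zero (M0 : ℝ) : D.state M0 0 = D.init M0 := rfl

lemma state_succ (M0 : ℝ) (j : ℕ) : D.state M0 (j + 1) = D.step (D.state M0 j) :=
  Function.iterate_succ_apply' _ _ _

lemma residual_eq (M0 : ℝ) (j : ℕ) :
    (D.state M0 j).r = D.Hbar (D.state M0 j).y + D.g := by
  induction j with
  | zero => simp [state_zero, init, Hbar]
  | succ j ih =>
    rw [state_succ]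
    simp only [step, Hbar_add, Hbar_smul]
    rw [ih]; abel

/-- Updates never decrease `M`, so what the update by `-g` guarantees holds at every later index. -/
lemma bump_init_le (M0 : ℝ) (j : ℕ) : D.bump M0 (-D.g) ≤ (D.state M0 j).M := by
  induction j with
  | zero => exact le_rfl
  | succ j ih =>
    rw [state_succ]
    exact ih.trans (((D.le_bump _ _).trans (D.le_bump _ _)).trans (D.le_bump _ _))

/-- Each pass updates `M` by the new `y`, and the remaining update by `r` only raises it. -/
lemma norm_H_y_le (M0 : ℝ) (j : ℕ) (hj : 1 ≤ j) :
    ‖D.H (D.state M0 j).y‖ ≤ (D.state M0 j).M * ‖(D.state M0 j).y‖ := by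
  obtain ⟨j, rfl⟩ := Nat.exists_eq_add_of_le' hj
  rw [state_succ]
  exact (D.norm_H_le_bump _ _).trans
    (mul_le_mul_of_nonneg_right (D.le_bump _ _) (norm_nonneg _))

variable {D} {a : ℝ}

lemma not_lowCurv (ha : ∀ v, a * ‖v‖ ^ 2 ≤ inner ℝ v (D.H v)) (hea : D.eps ≤ a)
    (hs : 0 ≤ D.tau * ‖D.g‖ ^ D.delta) (v : V) : ¬ D.LowCurv v := by
  unfold LowCurv Hbar
  rw [inner_add_right, inner_smul_right, real_inner_self_eq_norm_sq, not_lt]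
  have := ha v
  nlinarith [sq_nonneg ‖v‖, mul_nonneg hs (sq_nonneg ‖v‖)]

lemma mul_norm_le_of_coercive (ha : ∀ v, a * ‖v‖ ^ 2 ≤ inner ℝ v (D.H v)) (v : V) :
    a * ‖v‖ ≤ ‖D.H v‖ := by
  rcases eq_or_ne v 0 with rfl | hv
  · simp
  · have h1 := (ha v).trans (real_inner_le_norm v (D.H v))
    have h2 : 0 < ‖v‖ := norm_pos_iff.mpr hv
    exact le_of_mul_le_mul_left (by linarith [h1]) h2

/-- For a coercive operator the Capped CG method can only return an inexact solution of the
regularized Newton equation. -/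
theorem output_of_coercive (ha : ∀ v, a * ‖v‖ ^ 2 ≤ inner ℝ v (D.H v)) (hea : D.eps ≤ a)
    (hs : 0 ≤ D.tau * ‖D.g‖ ^ D.delta) (hg : D.g ≠ 0) {M0 : ℝ} {d : V} {ty : CGType}
    (h : D.Output M0 d ty) :
    ty = CGType.SOL ∧ ∃ M, a ≤ M ∧ ‖D.H d‖ ≤ M * ‖d‖ ∧
      ‖D.Hbar d + D.g‖ ≤ D.zetaHat M * ‖D.g‖ := by
  have hl := not_lowCurv ha hea hs
  rcases h with h | ⟨-, j, hj, -, h⟩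
  · exact absurd h.1 (hl _)
  rcases h with h | ⟨-, hr, rfl, rfl⟩ | h | h
  · exact absurd h.1 (hl _)
  · refine ⟨rfl, _, ?_, D.norm_H_y_le M0 j hj, ?_⟩
    -- The update by `-g` already forces `M ≥ ‖H g‖ / ‖g‖ ≥ a`.
    · refine le_trans ?_ (D.bump_init_le M0 j)
      have h1 := mul_norm_le_of_coercive ha (-D.g)
      have h2 := D.norm_H_le_bump M0 (-D.g)
      exact le_of_mul_le_mul_right (h1.trans h2) (by simpa using hg)
    · rw [← residual_eq]; exact hr
  · exact absurd h.2.2.1 (hl _)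
  · obtain ⟨i, -, h, -⟩ := h.2.2.2.2.2
    exact absurd h (hl _)

set_option maxHeartbeats 800000 in
/-- Estimates for the inexact regularized Newton direction. -/
theorem direction_estimates {e tau : ℝ} (he : 0 < e) (htau : 1 < tau)
    (hDe : D.eps = e) (hDt : D.tau = tau * e) (hz : 0 < D.zeta) (hz1 : D.zeta < 1)
    (hdel : 0 ≤ D.delta) (ha : ∀ v, 3 / 2 * e * ‖v‖ ^ 2 ≤ inner ℝ v (D.H v))
    (hg : D.g ≠ 0) (hg1 : ‖D.g‖ ≤ 1) {M0 : ℝ} {d : V} {ty : CGType} (h : D.Output M0 d ty) :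
    ty = CGType.SOL ∧ d ≠ 0 ∧ e * ‖d‖ ≤ ‖D.g‖ ∧ inner ℝ d D.g ≤ - inner ℝ d (D.H d) ∧
      ‖D.H d + D.g‖ ≤ (tau + 1) * ‖D.g‖ ^ (1 + D.delta) ∧
      ‖D.H d + D.g‖ ≤ (tau + 2 / 3) / (tau + 3 / 2) * ‖D.g‖ := by
  have hgp : 0 < ‖D.g‖ := norm_pos_iff.mpr hg
  set s := ‖D.g‖ ^ D.delta with hsdef
  have hs : 0 < s := Real.rpow_pos_of_pos hgp _
  have hs1 : s ≤ 1 := Real.rpow_le_one hgp.le hg1 hdel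
  set σ := tau * e * s with hσ
  have hσp : 0 < σ := by positivity
  obtain ⟨hty, M, hM, hHd, hr⟩ := output_of_coercive ha (by rw [hDe]; linarith)
    (by rw [hDt]; exact hσp.le) hg h
  set r := D.Hbar d + D.g with hrdef
  have hHbar : D.Hbar d = D.H d + σ • d := by simp [Hbar, hDt, hσ, hsdef]
  have hMs : 0 < M + σ := by nlinarith
  -- The definition of `ζ̂` cancels `M + σ`; this is why no upper bound on `M` is ever needed.
  have hzh : D.zetaHat M * (M + σ) = D.zeta / 3 * (e * s) := by
    have hes : 0 < e * s := by positivity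
    simp only [zetaHat, kcg, hDe, hDt, ← hsdef, ← hσ]
    field_simp
  set z := D.zetaHat M with hzdef
  have hes : e * s ≤ e := by nlinarith
  have heσ : e * s ≤ σ := by rw [hσ]; nlinarith [mul_pos he hs]
  have hz0 : 0 < z := by
    by_contra hcon
    have : 0 < D.zeta / 3 * (e * s) := by positivity
    nlinarith
  have hzs : z * (3 / 2 * e + σ) ≤ e * s / 3 := by
    have h1 : z * (3 / 2 * e + σ) ≤ z * (M + σ) := by gcongr
    have h2 : D.zeta / 3 * (e * s) ≤ e * s / 3 := by nlinarith [mul_pos he hs]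
    linarith
  have hz13 : z ≤ s / 3 := by
    have : z * e ≤ (s / 3) * e := by nlinarith [mul_pos hz0 he, mul_pos hz0 hσp]
    exact le_of_mul_le_mul_right this he
  have hr13 : ‖r‖ ≤ 1 / 3 * ‖D.g‖ := hr.trans (by gcongr; linarith)
  have hHbn : ‖D.Hbar d‖ ≤ (M + σ) * ‖d‖ := by
    rw [hHbar]
    refine (norm_add_le _ _).trans ?_
    rw [norm_smul, Real.norm_of_nonneg hσp.le]; linarith
  have hgle : ‖D.g‖ ≤ (M + σ) * ‖d‖ + ‖r‖ := by
    have : D.g = r - D.Hbar d := by rw [hrdef]; abel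
    calc ‖D.g‖ = ‖r - D.Hbar d‖ := by rw [← this]
      _ ≤ ‖r‖ + ‖D.Hbar d‖ := norm_sub_le _ _
      _ ≤ _ := by linarith
  have hd0 : d ≠ 0 := by
    rintro rfl
    rw [norm_zero] at hgle; linarith
  have hdp : 0 < ‖d‖ := norm_pos_iff.mpr hd0
  -- As `‖r‖ ≤ ‖g‖ / 3` and `M` bounds `H` at `d`, `‖g‖ ≤ (3/2)(M + σ)‖d‖`; multiplying by `ζ̂`
  -- removes `M`. The regularization term then absorbs `r` in the descent inequality.
  have hrd : ‖r‖ ≤ σ * ‖d‖ := by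
    have h1 : ‖D.g‖ ≤ 3 / 2 * ((M + σ) * ‖d‖) := by linarith
    have h2 : z * ‖D.g‖ ≤ z * (3 / 2 * ((M + σ) * ‖d‖)) := by gcongr
    have h3 : z * (3 / 2 * ((M + σ) * ‖d‖)) = D.zeta / 2 * (e * s) * ‖d‖ := by
      linear_combination (3 / 2 * ‖d‖) * hzh
    have h4 : D.zeta / 2 * (e * s) ≤ σ := by nlinarith [mul_pos he hs]
    calc ‖r‖ ≤ D.zeta / 2 * (e * s) * ‖d‖ := by linarith
      _ ≤ _ := by gcongr
  have hco : (3 / 2 * e + σ) * ‖d‖ ≤ ‖D.g‖ + ‖r‖ := by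
    have h1 : (3 / 2 * e + σ) * ‖d‖ ^ 2 ≤ inner ℝ d (D.Hbar d) := by
      rw [hHbar, inner_add_right, inner_smul_right, real_inner_self_eq_norm_sq]
      linarith [ha d]
    have h2 := real_inner_le_norm d (D.Hbar d)
    have h3 : ‖D.Hbar d‖ ≤ ‖D.g‖ + ‖r‖ := by
      have : D.Hbar d = r - D.g := by rw [hrdef]; abel
      rw [this, add_comm]; exact norm_sub_le _ _
    refine le_of_mul_le_mul_left ?_ hdp
    calc ‖d‖ * ((3 / 2 * e + σ) * ‖d‖) = (3 / 2 * e + σ) * ‖d‖ ^ 2 := by ring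
      _ ≤ ‖d‖ * ‖D.Hbar d‖ := h1.trans h2
      _ ≤ _ := by gcongr
  have hed : e * ‖d‖ ≤ ‖D.g‖ := by
    nlinarith [mul_pos hσp hdp]
  have hres : D.H d + D.g = r - σ • d := by rw [hrdef, hHbar]; abel
  have hresn : ‖D.H d + D.g‖ ≤ ‖r‖ + σ * ‖d‖ := by
    rw [hres]
    refine (norm_sub_le _ _).trans ?_
    rw [norm_smul, Real.norm_of_nonneg hσp.le]
  refine ⟨hty, hd0, hed, ?_, ?_, ?_⟩
  · have h1 : D.g = r - σ • d - D.H d := by rw [← hres]; abel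
    have h2 : inner ℝ d r ≤ ‖d‖ * ‖r‖ := real_inner_le_norm d r
    have h3 : inner ℝ d D.g = inner ℝ d r - σ * ‖d‖ ^ 2 - inner ℝ d (D.H d) := by
      conv_lhs => rw [h1]
      rw [inner_sub_right, inner_sub_right, inner_smul_right, real_inner_self_eq_norm_sq]
    nlinarith
  · rw [Real.rpow_add hgp, Real.rpow_one, ← hsdef]
    have h1 : σ * ‖d‖ ≤ tau * s * ‖D.g‖ := by
      calc σ * ‖d‖ = tau * s * (e * ‖d‖) := by rw [hσ]; ring
        _ ≤ _ := by gcongr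
    have h2 : z * ‖D.g‖ ≤ s * ‖D.g‖ := by gcongr; linarith
    linarith
  · have hσe : σ ≤ tau * e := by rw [hσ]; nlinarith [mul_pos (zero_lt_one.trans htau) he]
    exact contraction_factor he htau hσp.le (norm_nonneg _) (norm_nonneg _) hresn hco hr
      (hzs.trans (by linarith)) hσe

end CGData

variable {n : ℕ}

/-! ### Hessian and Taylor estimates -/

section Calculus

variable {f : Vec n → ℝ}

lemma contDiff_gradient (hf : ContDiff ℝ 2 f) : ContDiff ℝ 1 (gradient f) :=
  (InnerProductSpace.toDual ℝ (Vec n)).symm.contDiff.comp (hf.fderiv_right (by norm_num))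

/-- Passing through the Riesz isometry makes the symmetry of second derivatives available for the
Hessian matrix. -/
lemma inner_fderiv_gradient (hf : ContDiff ℝ 2 f) (x u v : Vec n) :
    inner ℝ (fderiv ℝ (gradient f) x u) v = fderiv ℝ (fderiv ℝ f) x u v := by
  have h1 : DifferentiableAt ℝ (fderiv ℝ f) x :=
    ((hf.fderiv_right (m := 1) (by norm_num)).differentiable one_ne_zero) x
  have h2 : fderiv ℝ (gradient f) x u =
      (InnerProductSpace.toDual ℝ (Vec n)).symm (fderiv ℝ (fderiv ℝ f) x u) := by
    have h3 := ((InnerProductSpace.toDual ℝ (Vec n)).symm.toContinuousLinearEquiv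
      |>.toContinuousLinearMap.hasFDerivAt.comp x h1.hasFDerivAt).fderiv
    exact congrArg (fun T => T u) h3
  rw [h2, InnerProductSpace.toDual_symm_apply]

lemma hess_isHermitian (hf : ContDiff ℝ 2 f) (x : Vec n) : (hess f x).IsHermitian := by
  ext i j
  have h1 := hf.contDiffAt (x := x) |>.isSymmSndFDerivAt (by simp)
    (EuclideanSpace.single i 1) (EuclideanSpace.single j 1)
  rw [← inner_fderiv_gradient hf, ← inner_fderiv_gradient hf] at h1
  simpa [hess, Matrix.conjTranspose_apply, EuclideanSpace.inner_single_right] using h1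

lemma hess_mulVec (x v : Vec n) (i : Fin n) :
    Matrix.mulVec (hess f x) v.ofLp i = fderiv ℝ (gradient f) x v i := by
  have hv : v = ∑ j, v j • EuclideanSpace.single j (1 : ℝ) := by
    ext k; simp [Pi.single_apply]
  conv_rhs => rw [hv]
  simp [Matrix.mulVec, dotProduct, hess, mul_comm]

lemma dotProduct_hess_mulVec (x v : Vec n) :
    dotProduct v.ofLp (Matrix.mulVec (hess f x) v.ofLp) =
      inner ℝ v (fderiv ℝ (gradient f) x v) := by
  simp only [dotProduct, hess_mulVec, PiLp.inner_apply]
  exact Finset.sum_congr rfl fun i _ => mul_comm _ _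

lemma inner_hess_ge {mu : ℝ} {x : Vec n}
    (h : (hess f x - mu • (1 : Matrix (Fin n) (Fin n) ℝ)).PosSemidef) (v : Vec n) :
    mu * ‖v‖ ^ 2 ≤ inner ℝ v (fderiv ℝ (gradient f) x v) := by
  have h1 := h.dotProduct_mulVec_nonneg v.ofLp
  rw [star_trivial, Matrix.sub_mulVec, dotProduct_sub, dotProduct_hess_mulVec, Matrix.smul_mulVec,
    Matrix.one_mulVec, dotProduct_smul] at h1
  have h2 : dotProduct v.ofLp v.ofLp = ‖v‖ ^ 2 := by
    rw [EuclideanSpace.real_norm_sq_eq]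
    exact Finset.sum_congr rfl fun i _ => (sq _).symm
  rw [h2, smul_eq_mul] at h1
  linarith

lemma hess_posSemidef (hf : ContDiff ℝ 2 f) {x : Vec n}
    (h : ∀ v, 0 ≤ inner ℝ v (fderiv ℝ (gradient f) x v)) : (hess f x).PosSemidef :=
  .of_dotProduct_mulVec_nonneg (hess_isHermitian hf x) fun v => by
    rw [star_trivial]
    exact (h (WithLp.toLp 2 v)).trans_eq (dotProduct_hess_mulVec x (WithLp.toLp 2 v)).symm

/-- A lower bound on the curvature persists under a small perturbation of the Hessian. -/
lemma inner_fderiv_ge_of_close {T T' : Vec n →L[ℝ] Vec n} {m c : ℝ}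
    (h : ∀ v, m * ‖v‖ ^ 2 ≤ inner ℝ v (T v)) (hT : ‖T' - T‖ ≤ c) (v : Vec n) :
    (m - c) * ‖v‖ ^ 2 ≤ inner ℝ v (T' v) := by
  have h1 : T' v = T v + (T' - T) v := by simp
  have h2 : -(‖v‖ * (c * ‖v‖)) ≤ inner ℝ v ((T' - T) v) := by
    refine (neg_le_neg ?_).trans (neg_le_of_abs_le (abs_real_inner_le_norm _ _))
    gcongr
    exact ((T' - T).le_opNorm v).trans (by gcongr)
  rw [h1, inner_add_right]
  have := h v
  linarith

/-- Mean value inequality on the segment, where the derivative differs from that at `x` by at most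
`L * ‖y - x‖`; the sharper constant `L / 2` is not needed. -/
lemma gradient_taylor (hf : ContDiff ℝ 2 f) {s : Set (Vec n)} (hs : Convex ℝ s) {L : ℝ}
    (hL : ∀ x ∈ s, ∀ y ∈ s,
      ‖fderiv ℝ (gradient f) y - fderiv ℝ (gradient f) x‖ ≤ L * ‖y - x‖) (hL0 : 0 ≤ L)
    {x y : Vec n} (hx : x ∈ s) (hy : y ∈ s) :
    ‖gradient f y - gradient f x - fderiv ℝ (gradient f) x (y - x)‖ ≤ L * ‖y - x‖ ^ 2 := by
  have h1 := (convex_segment (𝕜 := ℝ) x y).norm_image_sub_le_of_norm_fderiv_le' (𝕜 := ℝ)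
    (f := gradient f) (φ := fderiv ℝ (gradient f) x) (C := L * ‖y - x‖)
    (fun z _ => (contDiff_gradient hf).differentiable one_ne_zero z)
    (fun z hz => (hL x hx z (hs.segment_subset hx hy hz)).trans
      (mul_le_mul_of_nonneg_left (norm_sub_le_of_mem_segment hz) hL0))
    (left_mem_segment ℝ x y) (right_mem_segment ℝ x y)
  rwa [mul_assoc, ← sq] at h1

lemma hasDerivAt_line (hf : ContDiff ℝ 2 f) (x d : Vec n) (t : ℝ) :
    HasDerivAt (fun t : ℝ => f (x + t • d)) (inner ℝ (gradient f (x + t • d)) d) t := by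
  have h1 : HasFDerivAt f (fderiv ℝ f (x + t • d)) (x + t • d) :=
    (hf.differentiable two_ne_zero _).hasFDerivAt
  have h2 : HasDerivAt (fun t : ℝ => x + t • d) d t := by
    simpa using ((hasDerivAt_id t).smul_const d).const_add x
  rw [inner_gradient_left]
  exact h1.comp_hasDerivAt t h2

lemma function_taylor (hf : ContDiff ℝ 2 f) {s : Set (Vec n)} (hs : Convex ℝ s) {L : ℝ}
    (hL : ∀ x ∈ s, ∀ y ∈ s,
      ‖fderiv ℝ (gradient f) y - fderiv ℝ (gradient f) x‖ ≤ L * ‖y - x‖) (hL0 : 0 ≤ L)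
    {x d : Vec n} (hx : x ∈ s) (hy : x + d ∈ s) :
    f (x + d) ≤ f x + inner ℝ (gradient f x) d +
      inner ℝ d (fderiv ℝ (gradient f) x d) / 2 + L * ‖d‖ ^ 3 := by
  set A := fderiv ℝ (gradient f) x
  -- A comparison function for `f` along the segment. Its remainder is linear in `t`, because on
  -- `[0, 1]` the slope `L * ‖d‖ ^ 3` dominates the error `L * t ^ 2 * ‖d‖ ^ 3` of the derivative.
  have hB : ∀ t : ℝ, HasDerivAt (fun t : ℝ => f x + t * inner ℝ (gradient f x) d +
      t ^ 2 * (inner ℝ d (A d) / 2) + t * (L * ‖d‖ ^ 3))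
      (inner ℝ (gradient f x) d + t * inner ℝ d (A d) + L * ‖d‖ ^ 3) t := fun t => by
    have h := ((((hasDerivAt_id t).mul_const (inner ℝ (gradient f x) d)).const_add (f x)).add
      (((hasDerivAt_id t).pow 2).mul_const (inner ℝ d (A d) / 2))).add
      ((hasDerivAt_id t).mul_const (L * ‖d‖ ^ 3))
    refine HasDerivAt.congr_deriv h ?_
    simp only [id, Nat.cast_ofNat]; ring
  have h := image_le_of_deriv_right_le_deriv_boundary (a := 0) (b := 1)
    (f := fun t : ℝ => f (x + t • d)) (f' := fun t => inner ℝ (gradient f (x + t • d)) d)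
    (fun t _ => (hasDerivAt_line hf x d t).continuousAt.continuousWithinAt)
    (fun t _ => (hasDerivAt_line hf x d t).hasDerivWithinAt)
    (by simp) (fun t _ => (hB t).continuousAt.continuousWithinAt)
    (fun t _ => (hB t).hasDerivWithinAt) (fun t ht => ?_)
    (Set.right_mem_Icc.mpr (zero_le_one' ℝ))
  · simpa only [one_smul, one_mul, one_pow, add_assoc] using h
  · have hmem : x + t • d ∈ s := hs.add_smul_mem hx hy ⟨ht.1, ht.2.le⟩
    have h1 := gradient_taylor hf hs hL hL0 hx hmem
    rw [add_sub_cancel_left, norm_smul, Real.norm_of_nonneg ht.1, map_smul] at h1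
    have h2 : inner ℝ (gradient f (x + t • d)) d - inner ℝ (gradient f x) d - t * inner ℝ d (A d)
        = inner ℝ (gradient f (x + t • d) - gradient f x - t • A d) d := by
      rw [inner_sub_left, inner_sub_left, inner_smul_left, real_inner_comm d (A d)]; simp
    have h3 := (real_inner_le_norm (gradient f (x + t • d) - gradient f x - t • A d) d).trans
      (mul_le_mul_of_nonneg_right h1 (norm_nonneg d))
    have h4 : L * (t * ‖d‖) ^ 2 * ‖d‖ ≤ L * ‖d‖ ^ 3 := by
      have : t ^ 2 ≤ 1 := pow_le_one₀ ht.1 ht.2.le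
      calc L * (t * ‖d‖) ^ 2 * ‖d‖ = t ^ 2 * (L * ‖d‖ ^ 3) := by ring
        _ ≤ 1 * (L * ‖d‖ ^ 3) := by gcongr
        _ = _ := one_mul _
    linarith

end Calculus

/-! ### Restriction to an index set -/

section Subvectors

variable (I : Finset (Fin n))

lemma extend_of_notMem (d : EuclideanSpace ℝ I) {i : Fin n} (h : i ∉ I) : extend I d i = 0 := by
  simp [extend, h]

lemma inner_extend (d : EuclideanSpace ℝ I) (w : Vec n) :
    inner ℝ (extend I d) w = inner ℝ d (subvec I w) := by
  simp only [PiLp.inner_apply]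
  rw [← Finset.sum_subset (Finset.subset_univ I), ← Finset.sum_coe_sort I]
  · exact Finset.sum_congr rfl fun i _ => by simp [extend, subvec]
  · intro i _ hi; simp [extend, hi]

lemma subvec_extend (d : EuclideanSpace ℝ I) : subvec I (extend I d) = d := by
  ext i; simp [subvec, extend]

lemma norm_extend (d : EuclideanSpace ℝ I) : ‖extend I d‖ = ‖d‖ := by
  rw [← sq_eq_sq₀ (norm_nonneg _) (norm_nonneg _), ← real_inner_self_eq_norm_sq,
    ← real_inner_self_eq_norm_sq, inner_extend, subvec_extend]

lemma subvec_add (u v : Vec n) : subvec I (u + v) = subvec I u + subvec I v := rfl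

lemma norm_subvec_le (v : Vec n) : ‖subvec I v‖ ≤ ‖v‖ := by
  rw [← sq_le_sq₀ (norm_nonneg _) (norm_nonneg _), EuclideanSpace.real_norm_sq_eq,
    EuclideanSpace.real_norm_sq_eq]
  simp only [subvec]
  rw [Finset.sum_coe_sort I (fun i => v i ^ 2)]
  exact Finset.sum_le_sum_of_subset_of_nonneg (Finset.subset_univ _) fun _ _ _ => sq_nonneg _

lemma norm_subvec_eq {v : Vec n} (h : ∀ i ∉ I, v i = 0) : ‖subvec I v‖ = ‖v‖ := by
  rw [← norm_extend]
  congr 1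
  ext i
  by_cases hi : i ∈ I
  · simp [extend, subvec, hi]
  · simp [extend, hi, h i hi]

/-- The principal submatrix is the compression of the Hessian operator to vectors supported in `I`,
so it inherits coercivity. -/
lemma toEuclideanLin_subMat_hess (f : Vec n → ℝ) (x : Vec n) (d : EuclideanSpace ℝ I) :
    Matrix.toEuclideanLin (subMat I (hess f x)) d =
      subvec I (fderiv ℝ (gradient f) x (extend I d)) := by
  ext i
  simp only [subvec, ← hess_mulVec]
  simp only [Matrix.ofLp_toLpLin, Matrix.toLin'_apply, Matrix.mulVec, dotProduct, subMat,
    Matrix.submatrix_apply]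
  rw [← Finset.sum_subset (Finset.subset_univ I), ← Finset.sum_coe_sort I]
  · exact Finset.sum_congr rfl fun j _ => by simp [extend]
  · intro j _ hj; simp [extend, hj]

end Subvectors

/-! ### Approximate stationarity -/

section Stationarity

variable {f : Vec n → ℝ} {lam eps : ℝ}

lemma sub_clip_eq_zero_iff {a g : ℝ} (ha : 0 ≤ a) : g - min (max (-a) g) a = 0 ↔ |g| ≤ a := by
  rw [abs_le]
  constructor
  · intro h
    have h1 : g = min (max (-a) g) a := sub_eq_zero.mp h
    rw [h1]
    exact ⟨le_min (le_max_left _ _) (by linarith), min_le_right _ _⟩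
  · rintro ⟨h1, h2⟩
    rw [max_eq_right h1, min_eq_left h2, sub_self]

lemma gEps_of_gt {x : Vec n} {i : Fin n} (h : √eps < x i) :
    gEps f lam eps x i = gradient f x i + lam := by
  simp [gEps, h]

lemma gEps_of_lt {x : Vec n} {i : Fin n} (h : x i < -√eps) :
    gEps f lam eps x i = gradient f x i - lam := by
  have : ¬ √eps < x i := by linarith [Real.sqrt_nonneg eps]
  simp [gEps, h, this]

lemma gEps_of_abs_le {x : Vec n} {i : Fin n} (h : |x i| ≤ √eps) :
    gEps f lam eps x i = gradient f x i -
      min (max (-(lam + eps ^ (3 / 4 : ℝ))) (gradient f x i)) (lam + eps ^ (3 / 4 : ℝ)) := by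
  obtain ⟨h1, h2⟩ := abs_le.mp h
  simp only [gEps, not_lt.mpr h1, not_lt.mpr h2, if_false]
  rw [neg_add']

/-- Approximate stationarity in a coordinate, as a closed condition. -/
lemma gEps_eq_zero_iff (hlam : 0 < lam) (heps : 0 < eps) (x : Vec n) (i : Fin n) :
    gEps f lam eps x i = 0 ↔ (√eps ≤ x i ∧ gradient f x i = -lam) ∨
      (x i ≤ -√eps ∧ gradient f x i = lam) ∨
      (|x i| ≤ √eps ∧ |gradient f x i| ≤ lam + eps ^ (3 / 4 : ℝ)) := by
  have he : 0 < √eps := Real.sqrt_pos.mpr heps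
  have hc : 0 < eps ^ (3 / 4 : ℝ) := Real.rpow_pos_of_pos heps _
  rcases lt_or_ge (√eps) (x i) with h | h
  · rw [gEps_of_gt h, ← eq_neg_iff_add_eq_zero]
    have h1 : ¬ x i ≤ -√eps := by linarith
    have h2 : ¬ |x i| ≤ √eps := fun h2 => by linarith [le_abs_self (x i)]
    simp [h.le, h1, h2]
  rcases lt_or_ge (x i) (-√eps) with h' | h'
  · rw [gEps_of_lt h', sub_eq_zero]
    have h1 : ¬ √eps ≤ x i := by linarith
    have h2 : ¬ |x i| ≤ √eps := fun h2 => by linarith [neg_abs_le (x i)]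
    simp [h'.le, h1, h2]
  have h3 : |x i| ≤ √eps := abs_le.mpr ⟨h', h⟩
  rw [gEps_of_abs_le h3, sub_clip_eq_zero_iff (by linarith)]
  constructor
  · exact fun h4 => Or.inr (Or.inr ⟨h3, h4⟩)
  · rintro (⟨-, h4⟩ | ⟨-, h4⟩ | ⟨-, h4⟩)
    · rw [h4, abs_neg, abs_of_pos hlam]; linarith
    · rw [h4, abs_of_pos hlam]; linarith
    · exact h4

/-- Although `g^ε` may jump where `|x_i| = √eps`, its zero set is closed: the three cases of
`gEps_eq_zero_iff` are closed conditions, and they agree at the thresholds because `lam ≤ lam + eps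
^ (3/4)`. -/
lemma isClosed_gEps_eq_zero (hf : ContDiff ℝ 2 f) (hlam : 0 < lam) (heps : 0 < eps) :
    IsClosed {x | gEps f lam eps x = 0} := by
  have h : {x | gEps f lam eps x = 0} = ⋂ i : Fin n,
      ({x : Vec n | √eps ≤ x i ∧ gradient f x i = -lam} ∪
      ({x : Vec n | x i ≤ -√eps ∧ gradient f x i = lam} ∪
      {x : Vec n | |x i| ≤ √eps ∧ |gradient f x i| ≤ lam + eps ^ (3 / 4 : ℝ)})) := by
    ext x
    simp only [Set.mem_ofPred_eq, Set.mem_iInter, Set.mem_union, ← gEps_eq_zero_iff hlam heps]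
    exact ⟨fun h i => by rw [h]; rfl, fun h => by ext i; exact h i⟩
  rw [h]
  have hG : Continuous (gradient f) := (contDiff_gradient hf).continuous
  have hGi : ∀ i : Fin n, Continuous fun x => gradient f x i := fun i => by fun_prop
  have hi : ∀ i : Fin n, Continuous fun x : Vec n => x i := fun i => by fun_prop
  refine isClosed_iInter fun i => IsClosed.union ?_ (IsClosed.union ?_ ?_)
  · exact (isClosed_le continuous_const (hi i)).inter (isClosed_eq (hGi i) continuous_const)
  · exact (isClosed_le (hi i) continuous_const).inter (isClosed_eq (hGi i) continuous_const)
  · exact (isClosed_le (hi i).abs continuous_const).inter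
      (isClosed_le (hGi i).abs continuous_const)

lemma l1norm_add_single (x : Vec n) (i : Fin n) (s : ℝ) :
    l1norm (x + EuclideanSpace.single i s) = l1norm x + (|x i + s| - |x i|) := by
  rw [← sub_eq_iff_eq_add']
  unfold l1norm
  rw [← Finset.sum_sub_distrib, Finset.sum_eq_single i]
  · simp
  · intro j _ hj; simp [hj]
  · simp

/-- First-order optimality along a half-line on which the `ℓ₁` norm grows at most linearly. -/
lemma inner_gradient_nonneg_of_isMin (hf : ContDiff ℝ 2 f) (hlam : 0 < lam) {x v : Vec n}
    (hx : ∀ y, objective f lam x ≤ objective f lam y) {c s : ℝ} (hs : 0 < s)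
    (hc : ∀ t, 0 < t → t < s → l1norm (x + t • v) ≤ l1norm x + t * c) :
    0 ≤ inner ℝ (gradient f x) v + lam * c := by
  have h1 : HasDerivAt (fun t : ℝ => f (x + t • v) + lam * (t * c))
      (inner ℝ (gradient f x) v + lam * c) 0 := by
    have h2 := (hasDerivAt_line hf x v 0).add
      (((hasDerivAt_id (0 : ℝ)).mul_const c).const_mul lam)
    refine HasDerivAt.congr_deriv h2 ?_
    rw [zero_smul, add_zero, one_mul]
  refine ge_of_tendsto h1.tendsto_slope_zero_right ?_
  filter_upwards [Ioo_mem_nhdsGT hs] with t ht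
  have h3 := hx (x + t • v)
  have h4 := mul_le_mul_of_nonneg_left (hc t ht.1 ht.2) hlam.le
  unfold objective at h3
  refine smul_nonneg (inv_nonneg.mpr ht.1.le) ?_
  simp only [zero_add, zero_smul, add_zero, zero_mul, mul_zero]
  linarith

/-- Moving one coordinate either way gives `|∇_i f| ≤ lam`. If `|x_i| > √eps`, moving it towards
zero lowers the `ℓ₁` norm, which forces equality with the right sign. -/
lemma gEps_eq_zero_of_isMin (hf : ContDiff ℝ 2 f) (hlam : 0 < lam) (heps : 0 < eps) {x : Vec n}
    (hx : ∀ y, objective f lam x ≤ objective f lam y) : gEps f lam eps x = 0 := by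
  have he : 0 < √eps := Real.sqrt_pos.mpr heps
  have key : ∀ (i : Fin n) (a c s : ℝ), 0 < s →
      (∀ t, 0 < t → t < s → |x i + t * a| ≤ |x i| + t * c) →
      0 ≤ a * gradient f x i + lam * c := fun i a c s hs h => by
    have h1 := inner_gradient_nonneg_of_isMin hf hlam (v := EuclideanSpace.single i a) (c := c)
      hx hs fun t ht hts => by
        have h2 : t • EuclideanSpace.single i a = EuclideanSpace.single i (t * a) := by
          ext j; simp
        rw [h2, l1norm_add_single]
        linarith [h t ht hts]
    rw [EuclideanSpace.inner_single_right] at h1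
    simpa using h1
  ext i
  rw [PiLp.zero_apply, gEps_eq_zero_iff hlam heps]
  have hup := key i 1 1 1 one_pos fun t ht _ => by
    refine (abs_add_le _ _).trans ?_
    rw [mul_one, abs_of_pos ht]
  have hdown := key i (-1) 1 1 one_pos fun t ht _ => by
    refine (abs_add_le _ _).trans ?_
    rw [mul_neg_one, abs_neg, abs_of_pos ht, mul_one]
  rcases lt_or_ge (√eps) (x i) with h | h
  · have h1 := key i (-1) (-1) (√eps) he fun t ht hts => by
      rw [abs_of_pos (by linarith), abs_of_pos (by linarith)]
    exact Or.inl ⟨h.le, by linarith⟩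
  rcases lt_or_ge (x i) (-√eps) with h' | h'
  · have h1 := key i 1 (-1) (√eps) he fun t ht hts => by
      rw [abs_of_neg (by linarith), abs_of_neg (by linarith)]; linarith
    exact Or.inr (Or.inl ⟨h'.le, by linarith⟩)
  · have hc : 0 < eps ^ (3 / 4 : ℝ) := Real.rpow_pos_of_pos heps _
    exact Or.inr (Or.inr ⟨abs_le.mpr ⟨h', h⟩, abs_le.mpr ⟨by linarith, by linarith⟩⟩)

end Stationarity

/-! ### Nearest points and regions of uniform curvature -/

/-- A point close to `p` has a nearest point in a set through `p` that is locally closed there. -/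
lemma exists_nearest_of_locallyClosed {E : Type*} [PseudoMetricSpace E] [ProperSpace E]
    {S F : Set E} {p x : E} {R : ℝ} (hF : IsClosed F) (hSF : S ⊆ F)
    (hFS : F ∩ Metric.closedBall p R ⊆ S) (hp : p ∈ S) (hx : 2 * dist x p < R) :
    ∃ z ∈ S, dist z p ≤ R ∧ Metric.infDist x S = dist x z := by
  have hcl : IsClosed (F ∩ Metric.closedBall p R) := hF.inter Metric.isClosed_closedBall
  have hR : 0 < R := by linarith [dist_nonneg (x := x) (y := p)]
  have hpm : p ∈ F ∩ Metric.closedBall p R := ⟨hSF hp, Metric.mem_closedBall_self hR.le⟩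
  obtain ⟨z, hz, hzd⟩ := hcl.exists_infDist_eq_dist ⟨p, hpm⟩ x
  refine ⟨z, hFS hz, hz.2, le_antisymm (Metric.infDist_le_dist_of_mem (hFS hz)) ?_⟩
  refine (Metric.le_infDist ⟨p, hp⟩).mpr fun y hy => ?_
  rw [← hzd]
  by_cases hyR : dist y p ≤ R
  · exact Metric.infDist_le_dist_of_mem ⟨hSF hy, hyR⟩
  -- A point outside the closed ball is farther from `x` than `R - dist x p`, which exceeds `dist x
  -- p`, so `p` itself is closer.
  · refine (Metric.infDist_le_dist_of_mem hpm).trans ?_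
    have := dist_triangle y x p
    rw [dist_comm y x] at this
    linarith [not_le.mp hyR]

/-- Uniform curvature and smoothness of `f` on a convex set. -/
structure LocalRegularity (f : Vec n → ℝ) (e L Lg : ℝ) (s : Set (Vec n)) : Prop where
  convex : Convex ℝ s
  nonneg : 0 ≤ L
  lipschitz : ∀ x ∈ s, ∀ y ∈ s,
    ‖fderiv ℝ (gradient f) y - fderiv ℝ (gradient f) x‖ ≤ L * ‖y - x‖
  coercive : ∀ x ∈ s, ∀ v, 3 / 2 * e * ‖v‖ ^ 2 ≤ inner ℝ v (fderiv ℝ (gradient f) x v)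
  gradient_lipschitz : ∀ x ∈ s, ∀ y ∈ s, ‖gradient f y - gradient f x‖ ≤ Lg * ‖y - x‖

/-- Within radius `e / (2 * (K + 1))` the Hessian moves by at most `e / 2`, which lowers the
curvature from `2e` to no less than `3e/2`. Using `K + 1` avoids division by zero. -/
lemma exists_localRegularity {f : Vec n → ℝ} (hf : ContDiff ℝ 2 f) {U : Set (Vec n)}
    (hU : IsOpen U) {p : Vec n} (hp : p ∈ U) {K : NNReal}
    (hK : LipschitzOnWith K (fderiv ℝ (gradient f)) U) {e : ℝ} (he : 0 < e)
    (hco : ∀ v, 2 * e * ‖v‖ ^ 2 ≤ inner ℝ v (fderiv ℝ (gradient f) p v)) {b : ℝ} (hb : 0 < b) :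
    ∃ R L Lg, 0 < R ∧ R ≤ b ∧ 0 < Lg ∧ LocalRegularity f e L Lg (Metric.ball p R) := by
  obtain ⟨r, hr, hrU⟩ := Metric.isOpen_iff.mp hU p hp
  have hK1 : 0 < (K : ℝ) + 1 := by positivity
  set R := min (min b r) (e / (2 * (K + 1))) with hR
  have hR0 : 0 < R := by positivity
  have hsub : Metric.ball p R ⊆ U :=
    (Metric.ball_subset_ball ((min_le_left _ _).trans (min_le_right _ _))).trans hrU
  have hlip : ∀ x ∈ Metric.ball p R, ∀ y ∈ Metric.ball p R,
      ‖fderiv ℝ (gradient f) y - fderiv ℝ (gradient f) x‖ ≤ K * ‖y - x‖ := fun x hx y hy => by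
    simpa only [dist_eq_norm] using hK.dist_le_mul y (hsub hy) x (hsub hx)
  have hclose : ∀ x ∈ Metric.ball p R,
      ‖fderiv ℝ (gradient f) x - fderiv ℝ (gradient f) p‖ ≤ e / 2 := fun x hx => by
    refine (hlip p (Metric.mem_ball_self hR0) x hx).trans ?_
    have h1 : ‖x - p‖ ≤ e / (2 * (K + 1)) := by
      rw [← dist_eq_norm]; exact (Metric.mem_ball.mp hx).le.trans (min_le_right _ _)
    calc (K : ℝ) * ‖x - p‖ ≤ (K + 1) * (e / (2 * (K + 1))) := by gcongr; linarith
      _ = e / 2 := by field_simp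
  refine ⟨R, K, ‖fderiv ℝ (gradient f) p‖ + e, hR0, (min_le_left _ _).trans (min_le_left _ _),
    by positivity, convex_ball _ _, K.2, hlip, fun x hx v => ?_, fun x hx y hy => ?_⟩
  · have := inner_fderiv_ge_of_close hco (hclose x hx) v
    linarith
  · refine (convex_ball p R).norm_image_sub_le_of_norm_fderiv_le (𝕜 := ℝ)
      (fun z _ => (contDiff_gradient hf).differentiable one_ne_zero z) (fun z hz => ?_) hx hy
    have h1 := norm_le_norm_add_norm_sub' (fderiv ℝ (gradient f) z) (fderiv ℝ (gradient f) p)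
    linarith [hclose z hz]

/-! ### One iteration -/

section Step

variable {f : Vec n → ℝ} {lam eps : ℝ}

lemma mem_INonzero_iff {x : Vec n} {i : Fin n} :
    i ∈ INonzero eps x ↔ √eps < x i ∨ x i < -√eps := by
  simp [INonzero, IPos, INeg]

lemma mem_IZero_of_notMem {x : Vec n} {i : Fin n} (h : i ∉ INonzero eps x) :
    i ∈ IZero eps x := by
  rw [mem_INonzero_iff, not_or, not_lt, not_lt] at h
  simpa [IZero, abs_le] using h.symm

variable {P : Params}

lemma gEps_eq_zero_of_notMem {x : Vec n} (hx : ¬ ProxInvoked f lam P x) {i : Fin n}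
    (h : i ∉ INonzero P.epsg x) : gEps f lam P.epsg x i = 0 := by
  by_contra hne
  exact hx ⟨i, mem_IZero_of_notMem h, hne⟩

lemma gEps_eq_zero_of_notInvoked {x : Vec n} (hx : ¬ ProxInvoked f lam P x)
    (hx' : ¬ NewtonInvoked f lam P x) : gEps f lam P.epsg x = 0 := by
  ext i
  by_cases hi : i ∈ INonzero P.epsg x
  · by_contra hne
    exact hx' ⟨hx, i, hi, hne⟩
  · exact gEps_eq_zero_of_notMem hx hi

/-- Between points with the same sign pattern, `g^ε` changes on `I_{≠0}^ε` like the gradient. -/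
lemma gEps_sub_of_same_sign {x y : Vec n} {i : Fin n}
    (h : (√eps < x i ∧ √eps < y i) ∨ (x i < -√eps ∧ y i < -√eps)) :
    gEps f lam eps y i = gradient f y i - gradient f x i + gEps f lam eps x i := by
  rcases h with ⟨h1, h2⟩ | ⟨h1, h2⟩
  · rw [gEps_of_gt h1, gEps_of_gt h2]; ring
  · rw [gEps_of_lt h1, gEps_of_lt h2]; ring

/-- On directions supported in `I_{≠0}^ε` that keep the signs, `g^ε` is the derivative of the
objective, up to the curvature of `f`. -/
lemma inner_gEps_eq {x d : Vec n} (hd : ∀ i ∉ INonzero eps x, d i = 0)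
    (hsm : ∀ i, |d i| < √eps) :
    inner ℝ (gEps f lam eps x) d =
      inner ℝ (gradient f x) d + lam * (l1norm (x + d) - l1norm x) := by
  simp only [l1norm, PiLp.inner_apply, ← Finset.sum_sub_distrib, Finset.mul_sum]
  rw [← Finset.sum_add_distrib]
  refine Finset.sum_congr rfl fun i _ => ?_
  by_cases hi : i ∈ INonzero eps x
  · obtain ⟨h1, h2⟩ := abs_lt.mp (hsm i)
    have h0 := Real.sqrt_nonneg eps
    rcases mem_INonzero_iff.mp hi with h | h
    · rw [gEps_of_gt h, PiLp.add_apply, abs_of_pos (by linarith : 0 < x i),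
        abs_of_pos (by linarith)]
      simp; ring
    · rw [gEps_of_lt h, PiLp.add_apply, abs_of_neg (by linarith : x i < 0),
        abs_of_neg (by linarith)]
      simp; ring
  · simp [hd i hi]

/-- A Newton-CG step in a region of uniform curvature is a full inexact Newton step. -/
theorem newtonStep_full (hf : ContDiff ℝ 2 f) {L Lg : ℝ} {s : Set (Vec n)}
    (hreg : LocalRegularity f (√P.epsg) L Lg s) {x x' : Vec n} (hx : x ∈ s)
    (hball : ∀ d : Vec n, √P.epsg * ‖d‖ ≤ ‖gEps f lam P.epsg x‖ → x + d ∈ s)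
    (hg1 : ‖gEps f lam P.epsg x‖ ≤ 1) (hg2 : ‖gEps f lam P.epsg x‖ < √P.epsg ^ 2)
    (hg3 : 5 * L * ‖gEps f lam P.epsg x‖ ≤ √P.epsg ^ 2)
    (hinv : NewtonInvoked f lam P x) (hstep : NewtonStep f lam P x x') :
    ∃ d : EuclideanSpace ℝ (INonzero P.epsg x), x' = x + extend _ d ∧
      √P.epsg * ‖d‖ ≤ ‖gEps f lam P.epsg x‖ ∧
      ‖subvec (INonzero P.epsg x)
          (fderiv ℝ (gradient f) x (extend _ d) + gEps f lam P.epsg x)‖ ≤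
        (P.tau + 1) * ‖gEps f lam P.epsg x‖ ^ (1 + P.delta) ∧
      ‖subvec (INonzero P.epsg x)
          (fderiv ℝ (gradient f) x (extend _ d) + gEps f lam P.epsg x)‖ ≤
        (P.tau + 2 / 3) / (P.tau + 3 / 2) * ‖gEps f lam P.epsg x‖ := by
  set I := INonzero P.epsg x with hI
  set e := √P.epsg with he
  have he0 : 0 < e := Real.sqrt_pos.mpr P.epsg_pos
  set g := gEps f lam P.epsg x with hgdef
  have hgI : ‖subvec I g‖ = ‖g‖ := norm_subvec_eq I fun i hi => gEps_eq_zero_of_notMem hinv.1 hi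
  obtain ⟨M0, d, ty, -, hout, dk, rfl, j, hacc, hrej, rfl⟩ := hstep
  have hH : ∀ v, (newtonData f lam P x).H v = subvec I (fderiv ℝ (gradient f) x (extend I v)) :=
    toEuclideanLin_subMat_hess I f x
  have hco : ∀ v, 3 / 2 * e * ‖v‖ ^ 2 ≤ inner ℝ v ((newtonData f lam P x).H v) := fun v => by
    rw [hH, ← inner_extend, ← norm_extend I v]
    exact hreg.coercive x hx _
  have hg0 : (newtonData f lam P x).g ≠ 0 := by
    obtain ⟨i, hi, hne⟩ := hinv.2
    exact fun h => hne (congrArg (fun v : EuclideanSpace ℝ I => v ⟨i, hi⟩) h)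
  have hDg : ‖(newtonData f lam P x).g‖ = ‖g‖ := hgI
  obtain ⟨rfl, hd0, hed, hdesc, hsup, hlin⟩ := CGData.direction_estimates he0 P.tau_gt
    (D := newtonData f lam P x) rfl rfl P.zeta_pos P.zeta_lt P.delta_nonneg hco hg0
    (hDg.le.trans hg1) hout
  rw [hDg] at hed
  rw [hDg, hH] at hsup hlin
  rw [hH, ← inner_extend] at hdesc
  have hdesc' : inner ℝ (extend I d) g ≤
      -inner ℝ (extend I d) (fderiv ℝ (gradient f) x (extend I d)) := by
    rw [inner_extend]; exact hdesc
  have hdk : newtonDir (newtonData f lam P x) d CGType.SOL = d := rfl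
  rw [hdk] at hacc hrej ⊢
  have hxd : x + extend I d ∈ s := hball _ (by rw [norm_extend]; exact hed)
  have hdpos : 0 < ‖extend I d‖ := by rw [norm_extend]; exact norm_pos_iff.mpr hd0
  have hed' : e * ‖extend I d‖ ≤ ‖g‖ := by rw [norm_extend]; exact hed
  set dk := extend I d with hdkdef
  -- A step shorter than `√ε_g` takes no coordinate of `I` through zero, so the `ℓ₁` norm is affine
  -- along it.
  have hdlt : ‖dk‖ < e := by
    refine lt_of_mul_lt_mul_left (a := e) ?_ he0.le
    rw [← sq]; exact hed'.trans_lt hg2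
  -- The objective changes by at most `-⟨d, H d⟩ / 2 + L‖d‖³ ≤ (-3/4 + 1/5) e ‖d‖²`, which beats
  -- `-eta * e * ‖d‖²` as `eta < 1/2`.
  have hfull : NewtonAccepted f lam P (P.theta ^ 0) x dk := by
    have h1 := function_taylor hf hreg.convex hreg.lipschitz hreg.nonneg hx hxd
    have h2 := inner_gEps_eq (f := f) (lam := lam) (eps := P.epsg) (x := x) (d := dk)
      (fun i hi => extend_of_notMem _ _ hi)
      (fun i => (PiLp.norm_apply_le dk i).trans_lt hdlt)
    rw [real_inner_comm] at h2
    have h3 := hreg.coercive x hx dk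
    have h4 : L * ‖dk‖ ≤ e / 5 := by
      have : e * (L * ‖dk‖) ≤ e * (e / 5) := by
        have := mul_le_mul_of_nonneg_left hed' hreg.nonneg
        linarith
      exact le_of_mul_le_mul_left this he0
    have h5 : L * ‖dk‖ ^ 3 ≤ e / 5 * ‖dk‖ ^ 2 := by
      calc L * ‖dk‖ ^ 3 = L * ‖dk‖ * ‖dk‖ ^ 2 := by ring
        _ ≤ _ := by gcongr
    have h6 : P.eta < 1 / 2 := by linarith [P.eta_lt, P.zeta_pos]
    have h7 : P.eta * (e * ‖dk‖ ^ 2) < 1 / 2 * (e * ‖dk‖ ^ 2) := by gcongr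
    have h8 : 0 < e * ‖dk‖ ^ 2 := by positivity
    simp only [NewtonAccepted, objective, pow_zero, one_smul, one_pow, mul_one, ← he]
    linarith
  have hj : j = 0 := by
    by_contra hj
    exact hrej 0 (Nat.pos_of_ne_zero hj) hfull
  subst hj
  exact ⟨d, by rw [pow_zero, one_smul], hed, hsup, hlin⟩

/-- Once no proximal gradient step follows, the new residual is that of the linearized equation. -/
lemma norm_gEps_newton_le (hf : ContDiff ℝ 2 f) {e L Lg : ℝ} {s : Set (Vec n)}
    (hreg : LocalRegularity f e L Lg s) {x d : Vec n} (hx : x ∈ s) (hxd : x + d ∈ s)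
    (hdI : ∀ i ∉ INonzero P.epsg x, d i = 0) (hd : ‖d‖ < √P.epsg)
    (hpx : ¬ ProxInvoked f lam P (x + d)) :
    ‖gEps f lam P.epsg (x + d)‖ ≤
      ‖subvec (INonzero P.epsg x) (fderiv ℝ (gradient f) x d + gEps f lam P.epsg x)‖ +
        L * ‖d‖ ^ 2 := by
  set I := INonzero P.epsg x with hI
  set w := gradient f (x + d) - gradient f x + gEps f lam P.epsg x with hw
  have he0 : 0 ≤ √P.epsg := Real.sqrt_nonneg _
  -- A coordinate beyond the threshold at `x + d` was already in `I`, since `d` vanishes off `I`. It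
  -- kept its sign, since a change would need a move of more than `2√ε_g`. At all other coordinates
  -- the absence of a proximal step gives zero.
  have hval : ∀ i, gEps f lam P.epsg (x + d) i = 0 ∨
      (i ∈ I ∧ gEps f lam P.epsg (x + d) i = w i) := fun i => by
    by_cases hi : i ∈ INonzero P.epsg (x + d)
    · right
      have hdi := abs_lt.mp ((PiLp.norm_apply_le d i).trans_lt hd)
      have hiI : i ∈ I := by
        by_contra hiI
        have h0 : d i = 0 := hdI i hiI
        rw [mem_INonzero_iff, PiLp.add_apply, h0, add_zero, ← mem_INonzero_iff] at hi
        exact hiI hi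
      refine ⟨hiI, gEps_sub_of_same_sign ?_⟩
      rw [mem_INonzero_iff, PiLp.add_apply] at hi
      rw [hI, mem_INonzero_iff] at hiI
      rw [PiLp.add_apply]
      rcases hi with h1 | h1 <;> rcases hiI with h2 | h2
      · exact Or.inl ⟨h2, h1⟩
      · linarith
      · linarith
      · exact Or.inr ⟨h2, h1⟩
    · exact Or.inl (gEps_eq_zero_of_notMem hpx hi)
  have h1 : ‖gEps f lam P.epsg (x + d)‖ ≤ ‖subvec I w‖ := by
    have h2 : ∀ i ∉ I, gEps f lam P.epsg (x + d) i = 0 := fun i hi =>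
      (hval i).resolve_right fun h => hi h.1
    rw [← norm_subvec_eq I h2, ← sq_le_sq₀ (norm_nonneg _) (norm_nonneg _),
      EuclideanSpace.real_norm_sq_eq, EuclideanSpace.real_norm_sq_eq]
    refine Finset.sum_le_sum fun i _ => ?_
    simp only [subvec]
    rcases hval i with h | ⟨-, h⟩
    · rw [h, zero_pow two_ne_zero]; exact sq_nonneg _
    · rw [h]
  have h2 : w = (fderiv ℝ (gradient f) x d + gEps f lam P.epsg x) +
      (gradient f (x + d) - gradient f x - fderiv ℝ (gradient f) x d) := by rw [hw]; abel
  have h3 := gradient_taylor hf hreg.convex hreg.lipschitz hreg.nonneg hx hxd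
  rw [add_sub_cancel_left] at h3
  rw [h2, subvec_add] at h1
  exact h1.trans ((norm_add_le _ _).trans
    (add_le_add_right ((norm_subvec_le I _).trans h3) _))

/-- One iteration without proximal gradient step in a region of uniform curvature. -/
theorem step_estimate (hf : ContDiff ℝ 2 f) {L Lg : ℝ} {s : Set (Vec n)}
    (hreg : LocalRegularity f (√P.epsg) L Lg s) {x x' : Vec n} (hx : x ∈ s)
    (hball : ∀ d : Vec n, √P.epsg * ‖d‖ ≤ ‖gEps f lam P.epsg x‖ → x + d ∈ s)
    (hg1 : ‖gEps f lam P.epsg x‖ ≤ 1) (hg2 : ‖gEps f lam P.epsg x‖ < √P.epsg ^ 2)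
    (hg3 : 3 * (P.tau + 3 / 2) * L * ‖gEps f lam P.epsg x‖ ≤ √P.epsg ^ 2)
    (hpx : ¬ ProxInvoked f lam P x) (hpx' : ¬ ProxInvoked f lam P x')
    (hstep : NewtonInvoked f lam P x → NewtonStep f lam P x x')
    (hstay : ¬ NewtonInvoked f lam P x → x' = x) :
    √P.epsg * ‖x' - x‖ ≤ ‖gEps f lam P.epsg x‖ ∧
      ‖gEps f lam P.epsg x'‖ ≤
        (P.tau + 1 + L / √P.epsg ^ 2) * ‖gEps f lam P.epsg x‖ ^ (1 + P.delta) ∧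
      ‖gEps f lam P.epsg x'‖ ≤ (P.tau + 1) / (P.tau + 3 / 2) * ‖gEps f lam P.epsg x‖ := by
  have hdel : 0 < 1 + P.delta := by linarith [P.delta_nonneg]
  by_cases hinv : NewtonInvoked f lam P x
  · have ht := P.tau_gt
    have he0 : 0 < √P.epsg := Real.sqrt_pos.mpr P.epsg_pos
    set g := gEps f lam P.epsg x with hg
    have hLg : 0 ≤ L * ‖g‖ := mul_nonneg hreg.nonneg (norm_nonneg _)
    obtain ⟨d, rfl, hd, hsup, hlin⟩ := newtonStep_full hf hreg hx hball hg1 hg2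
      (by nlinarith) hinv (hstep hinv)
    have hdlt : ‖d‖ < √P.epsg := by
      refine lt_of_mul_lt_mul_left (a := √P.epsg) ?_ he0.le
      rw [← sq]; exact hd.trans_lt hg2
    have h1 := norm_gEps_newton_le hf hreg hx (hball _ (by rw [norm_extend]; exact hd))
      (fun i hi => extend_of_notMem _ _ hi) (by rwa [norm_extend]) hpx'
    rw [norm_extend] at h1
    have h2 : L * ‖d‖ ^ 2 ≤ L / √P.epsg ^ 2 * ‖g‖ ^ 2 := by
      rw [div_mul_eq_mul_div, le_div_iff₀ (by positivity), mul_assoc, ← mul_pow]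
      have := hreg.nonneg
      gcongr
      rwa [mul_comm]
    refine ⟨by rw [add_sub_cancel_left, norm_extend]; exact hd, ?_, ?_⟩
    -- Here `delta ≤ 1` enters: the quadratic Taylor remainder is no worse than order `1 + delta`.
    · have h3 : ‖g‖ ^ 2 ≤ ‖g‖ ^ (1 + P.delta) := by
        rw [← Real.rpow_natCast]
        refine Real.rpow_le_rpow_of_exponent_ge_of_imp (norm_nonneg _) hg1 ?_ ?_
        · push_cast; linarith [P.delta_le]
        · intro _ h; norm_num at h
      have h4 : L / √P.epsg ^ 2 * ‖g‖ ^ 2 ≤ L / √P.epsg ^ 2 * ‖g‖ ^ (1 + P.delta) := by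
        have := hreg.nonneg
        gcongr
      linarith
    -- The Taylor remainder uses up the `1/3` by which the final factor exceeds the one for the
    -- linearized residual.
    · have h3 : L / √P.epsg ^ 2 * ‖g‖ ^ 2 ≤ (1 / 3) / (P.tau + 3 / 2) * ‖g‖ := by
        rw [sq ‖g‖, ← mul_assoc]
        gcongr
        rw [div_mul_eq_mul_div, div_le_div_iff₀ (by positivity) (by linarith)]
        linarith
      have h4 : (P.tau + 1) / (P.tau + 3 / 2) =
          (P.tau + 2 / 3) / (P.tau + 3 / 2) + (1 / 3) / (P.tau + 3 / 2) := by
        rw [← add_div]; congr 1; ring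
      rw [h4, add_mul]
      linarith
  · rw [hstay hinv, gEps_eq_zero_of_notInvoked hpx hinv]
    simp [Real.zero_rpow hdel.ne']

/-- The residual is bounded by the distance to a nearest point with the same sign pattern. -/
lemma norm_gEps_le_of_same_pattern {e L Lg : ℝ} {s : Set (Vec n)}
    (hreg : LocalRegularity f e L Lg s) {x z : Vec n} (hx : x ∈ s) (hz : z ∈ s)
    (hgz : gEps f lam P.epsg z = 0) (hpx : ¬ ProxInvoked f lam P x)
    (hpos : IPos P.epsg z = IPos P.epsg x) (hneg : INeg P.epsg z = INeg P.epsg x) :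
    ‖gEps f lam P.epsg x‖ ≤ Lg * ‖x - z‖ := by
  refine le_trans ?_ (hreg.gradient_lipschitz z hz x hx)
  rw [← sq_le_sq₀ (norm_nonneg _) (norm_nonneg _), EuclideanSpace.real_norm_sq_eq,
    EuclideanSpace.real_norm_sq_eq]
  refine Finset.sum_le_sum fun i _ => ?_
  have hp : √P.epsg < z i ↔ √P.epsg < x i := by
    simpa [IPos] using congrArg (i ∈ ·) hpos
  have hn : z i < -√P.epsg ↔ x i < -√P.epsg := by
    simpa [INeg] using congrArg (i ∈ ·) hneg
  by_cases hi : i ∈ INonzero P.epsg x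
  · have hsame : (√P.epsg < z i ∧ √P.epsg < x i) ∨ (z i < -√P.epsg ∧ x i < -√P.epsg) := by
      rcases mem_INonzero_iff.mp hi with h | h
      · exact Or.inl ⟨hp.mpr h, h⟩
      · exact Or.inr ⟨hn.mpr h, h⟩
    rw [gEps_sub_of_same_sign (f := f) (lam := lam) hsame, hgz]
    simp
  · rw [gEps_eq_zero_of_notMem hpx hi, zero_pow two_ne_zero]
    positivity

end Step

/-! ### Uniform estimates near the solution and trapping -/

/-- Estimates for all iterations, without proximal gradient step, near a solution with uniform
curvature: nearest approximate stationary points exist, the residual is bounded by the distance to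
them, and it contracts. -/
theorem exists_radius_step_estimate {f : Vec n → ℝ} {lam : ℝ} (hlam : 0 < lam) {P : Params}
    (hf : ContDiff ℝ 2 f) {p : Vec n} (hp : ∀ y, objective f lam p ≤ objective f lam y)
    {U : Set (Vec n)} (hU : IsOpen U) (hpU : p ∈ U) {K : NNReal}
    (hK : LipschitzOnWith K (fderiv ℝ (gradient f)) U)
    (hco : ∀ v, 2 * √P.epsg * ‖v‖ ^ 2 ≤ inner ℝ v (fderiv ℝ (gradient f) p v))
    {b : ℝ} (hb : 0 < b) :
    p ∈ SStar f lam P.epsg ∧ ∃ R C Lg : ℝ, 0 < R ∧ R ≤ b ∧ 0 < C ∧ 0 < Lg ∧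
      (∀ x ∈ Metric.ball p R, ∃ z ∈ SStar f lam P.epsg,
        Metric.infDist x (SStar f lam P.epsg) = dist x z) ∧
      ∀ x ∈ Metric.ball p R, ∀ x', ¬ ProxInvoked f lam P x → ¬ ProxInvoked f lam P x' →
        (NewtonInvoked f lam P x → NewtonStep f lam P x x') →
        (¬ NewtonInvoked f lam P x → x' = x) →
        (∀ z ∈ SStar f lam P.epsg, ‖x - z‖ = Metric.infDist x (SStar f lam P.epsg) →
          IPos P.epsg z = IPos P.epsg x ∧ INeg P.epsg z = INeg P.epsg x) →
        ‖gEps f lam P.epsg x‖ ≤ Lg * Metric.infDist x (SStar f lam P.epsg) ∧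
        √P.epsg * ‖x' - x‖ ≤ ‖gEps f lam P.epsg x‖ ∧
        ‖gEps f lam P.epsg x'‖ ≤ C * ‖gEps f lam P.epsg x‖ ^ (1 + P.delta) ∧
        ‖gEps f lam P.epsg x'‖ ≤ (P.tau + 1) / (P.tau + 3 / 2) * ‖gEps f lam P.epsg x‖ := by
  have he : 0 < √P.epsg := Real.sqrt_pos.mpr P.epsg_pos
  have ht := P.tau_gt
  obtain ⟨R0, L, Lg, hR0, hR0b, hLg, hreg⟩ := exists_localRegularity hf hU hpU hK he hco hb
  have hL := hreg.nonneg
  have hpsd : ∀ x ∈ Metric.ball p R0, (hess f x).PosSemidef := fun x hx =>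
    hess_posSemidef hf fun v => le_trans (by positivity) (hreg.coercive x hx v)
  have hpS : p ∈ SStar f lam P.epsg :=
    ⟨gEps_eq_zero_of_isMin hf hlam P.epsg_pos hp,
      (hpsd p (Metric.mem_ball_self hR0)).submatrix _⟩
  have hnear : ∀ x, 4 * dist x p < R0 → ∃ z ∈ SStar f lam P.epsg, dist z p ≤ R0 / 2 ∧
      Metric.infDist x (SStar f lam P.epsg) = dist x z := fun x hx => by
    refine exists_nearest_of_locallyClosed (isClosed_gEps_eq_zero hf hlam P.epsg_pos)
      (fun z hz => hz.1) (fun z hz => ⟨hz.1, (hpsd z ?_).submatrix _⟩) hpS (by linarith)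
    exact Metric.mem_ball.mpr ((Metric.mem_closedBall.mp hz.2).trans_lt (by linarith))
  -- The three terms secure the three smallness hypotheses on `‖g^ε‖` in `step_estimate`; the factor
  -- `1/2` makes the second strict.
  set c := min 1 (min (√P.epsg ^ 2 / 2) (√P.epsg ^ 2 / (3 * (P.tau + 3 / 2) * (L + 1)))) with hc
  have hc0 : 0 < c := by positivity
  have hc2 : c ≤ √P.epsg ^ 2 / 2 := (min_le_right _ _).trans (min_le_left _ _)
  have hc3 : 3 * (P.tau + 3 / 2) * L * c ≤ √P.epsg ^ 2 := by
    have h1 : c ≤ √P.epsg ^ 2 / (3 * (P.tau + 3 / 2) * (L + 1)) :=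
      (min_le_right _ _).trans (min_le_right _ _)
    rw [le_div_iff₀ (by positivity)] at h1
    have h2 : 0 ≤ 3 * (P.tau + 3 / 2) * c := by positivity
    linarith
  -- The terms give, in turn, nearest points inside the regular ball, `‖g^ε‖ ≤ c`, and room for a
  -- step of length `Lg * R / √ε_g`.
  set R := min (R0 / 4) (min (c / Lg) (R0 / (1 + Lg / √P.epsg))) with hR
  have hRpos : 0 < R := by positivity
  have hR4 : R ≤ R0 / 4 := min_le_left _ _
  have hRc : Lg * R ≤ c := by
    have h1 : R ≤ c / Lg := (min_le_right _ _).trans (min_le_left _ _)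
    rwa [le_div_iff₀' hLg] at h1
  have hRe : R + Lg * R / √P.epsg ≤ R0 := by
    have h1 : R ≤ R0 / (1 + Lg / √P.epsg) := (min_le_right _ _).trans (min_le_right _ _)
    rw [le_div_iff₀ (by positivity)] at h1
    calc R + Lg * R / √P.epsg = R * (1 + Lg / √P.epsg) := by ring
      _ ≤ R0 := h1
  refine ⟨hpS, R, P.tau + 1 + L / √P.epsg ^ 2, Lg, hRpos, by linarith, by positivity, hLg,
    fun x hx => ?_, fun x hx x' hpx hpx' hstep hstay hsign => ?_⟩
  · rw [Metric.mem_ball] at hx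
    obtain ⟨z, hz, -, h⟩ := hnear x (by linarith)
    exact ⟨z, hz, h⟩
  rw [Metric.mem_ball] at hx
  have hxs : x ∈ Metric.ball p R0 := Metric.mem_ball.mpr (by linarith)
  obtain ⟨z, hz, hzp, hzd⟩ := hnear x (by linarith)
  obtain ⟨hpos, hneg⟩ := hsign z hz (by rw [hzd, dist_eq_norm])
  have hg := norm_gEps_le_of_same_pattern hreg hxs (Metric.mem_ball.mpr (by linarith)) hz.1 hpx
    hpos hneg
  rw [← dist_eq_norm, ← hzd] at hg
  have hgc : ‖gEps f lam P.epsg x‖ ≤ Lg * R := hg.trans (by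
    gcongr; exact (Metric.infDist_le_dist_of_mem hpS).trans hx.le)
  have hgc' := hgc.trans hRc
  refine ⟨hg, step_estimate hf hreg hxs (fun d hd => ?_) (hgc'.trans (min_le_left _ _))
    (by linarith [pow_pos he 2]) (le_trans (by gcongr) hc3) hpx hpx' hstep hstay⟩
  rw [Metric.mem_ball]
  have h1 : ‖d‖ ≤ Lg * R / √P.epsg := by
    rw [le_div_iff₀' he]; exact hd.trans hgc
  calc dist (x + d) p ≤ dist (x + d) x + dist x p := dist_triangle _ _ _
    _ = ‖d‖ + dist x p := by rw [dist_eq_norm, add_sub_cancel_left]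
    _ < R0 := by linarith

/-- A sequence whose steps are bounded by a linearly decreasing quantity, as long as it stays in a
ball, stays in the ball if it starts close enough to the centre. -/
lemma geometric_trapping {E : Type*} [SeminormedAddCommGroup E] {u : ℕ → E} {g : ℕ → ℝ} {p : E}
    {e ρ R : ℝ} (he : 0 < e) (hρ0 : 0 ≤ ρ) (hρ : ρ < 1) (hg : ∀ m, 0 ≤ g m)
    (hstep : ∀ m, ‖u m - p‖ < R → e * ‖u (m + 1) - u m‖ ≤ g m ∧ g (m + 1) ≤ ρ * g m)
    (h0 : ‖u 0 - p‖ + g 0 / (e * (1 - ρ)) < R) (m : ℕ) :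
    ‖u m - p‖ ≤ ‖u 0 - p‖ + g 0 / (e * (1 - ρ)) ∧ g m ≤ ρ ^ m * g 0 := by
  have hρ' : 0 < 1 - ρ := by linarith
  -- The second summand bounds the total length of all remaining steps by a geometric series, so the
  -- sum is nonincreasing and the induction closes.
  suffices h : ‖u m - p‖ + g m / (e * (1 - ρ)) ≤ ‖u 0 - p‖ + g 0 / (e * (1 - ρ)) ∧
      g m ≤ ρ ^ m * g 0 from
    ⟨le_trans (le_add_of_nonneg_right (div_nonneg (hg m) (by positivity))) h.1, h.2⟩
  induction m with
  | zero => simp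
  | succ m ih =>
    have hd : 0 ≤ g m / (e * (1 - ρ)) := div_nonneg (hg m) (by positivity)
    obtain ⟨h1, h2⟩ := hstep m (by linarith [ih.1])
    constructor
    · refine le_trans ?_ ih.1
      have h3 : ‖u (m + 1) - p‖ ≤ ‖u (m + 1) - u m‖ + ‖u m - p‖ :=
        norm_sub_le_norm_sub_add_norm_sub _ _ _
      have h4 : ‖u (m + 1) - u m‖ ≤ g m / e := by rwa [le_div_iff₀' he]
      have h5 : g (m + 1) / (e * (1 - ρ)) ≤ ρ * g m / (e * (1 - ρ)) := by gcongr
      have h6 : g m / e + ρ * g m / (e * (1 - ρ)) = g m / (e * (1 - ρ)) := by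
        field_simp; ring
      linarith
    · calc g (m + 1) ≤ ρ * g m := h2
        _ ≤ ρ * (ρ ^ m * g 0) := by gcongr; exact ih.2
        _ = _ := by ring

end L1Newton

end

/-! ### The main theorem -/

theorem mainTheorem9 {n : ℕ} (f : L1Newton.Vec n → ℝ) (lam : ℝ) (hlam : 0 < lam)
    (P : L1Newton.Params) (x0 xs : L1Newton.Vec n) (mu kappa b1 : ℝ)
    (hf : ContDiff ℝ 2 f)
    (hlevel : L1Newton.LevelSetAssumption f lam x0)
    -- `f` is convex, `xs` solves the problem and the Hessian of `f` at `xs` exceeds `mu I`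
    (hconv : ConvexOn ℝ Set.univ f)
    (hxs : ∀ y, L1Newton.objective f lam xs ≤ L1Newton.objective f lam y)
    (hmu : 0 < mu)
    (hhess : (L1Newton.hess f xs - mu • (1 : Matrix (Fin n) (Fin n) ℝ)).PosDef)
    (heps : P.epsg ≤ mu ^ 2 / 4)
    -- the error bound with exponent one
    (hkappa : 0 < kappa) (hb1 : 0 < b1) (hb1' : b1 < 1)
    (herr : L1Newton.ErrorBound f lam P.epsg 1 kappa b1 xs) :
    ∃ C > 0, ∃ rho : ℝ, 0 < rho ∧ rho < 1 ∧ ∀ b > 0, ∃ r > 0,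
      ∀ x : ℕ → L1Newton.Vec n, x 0 = x0 → L1Newton.Generated f lam P x →
        L1Newton.SignPatternAssumption f lam P.epsg b1 xs x →
        ∀ K : ℕ, (∀ k ≥ K, ¬ L1Newton.ProxInvoked f lam P (x k)) → x K ∈ Metric.ball xs r →
          (Tendsto (fun k => Metric.infDist (x k) (L1Newton.SStar f lam P.epsg)) atTop (𝓝 0) ∧
            (∀ k ≥ K, Metric.infDist (x (k + 1)) (L1Newton.SStar f lam P.epsg) ≤
              C * Metric.infDist (x k) (L1Newton.SStar f lam P.epsg) ^ (1 + P.delta)) ∧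
            (∀ m : ℕ, Metric.infDist (x (K + m)) (L1Newton.SStar f lam P.epsg) ≤
              C * rho ^ m * Metric.infDist (x K) (L1Newton.SStar f lam P.epsg))) ∧
          ∃ xhat ∈ L1Newton.SStar f lam P.epsg ∩ Metric.ball xs b,
            Tendsto x atTop (𝓝 xhat) := by
  have he : 0 < √P.epsg := Real.sqrt_pos.mpr P.epsg_pos
  have ht := P.tau_gt
  have hdel : 0 < 1 + P.delta := by linarith [P.delta_nonneg]
  obtain ⟨U, hU, hsub, -, Lip, hLip⟩ := hlevel.smooth
  have hemu : 2 * √P.epsg ≤ mu := by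
    have h1 : √P.epsg ≤ mu / 2 := by
      rw [Real.sqrt_le_left (by positivity)]
      linarith [heps, show (mu / 2) ^ 2 = mu ^ 2 / 4 by ring]
    linarith
  have hco : ∀ v, 2 * √P.epsg * ‖v‖ ^ 2 ≤ inner ℝ v (fderiv ℝ (gradient f) xs v) := fun v =>
    (mul_le_mul_of_nonneg_right hemu (sq_nonneg _)).trans
      (L1Newton.inner_hess_ge hhess.posSemidef v)
  -- The minimizer lies in the level set of `x0`, hence in `U`. Taking `b1` as the cap on `R` keeps
  -- the error bound and the sign pattern assumption applicable.
  obtain ⟨hxsS, R, C1, Lg, hR, hRb, hC1, hLg, hnear, hest⟩ :=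
    L1Newton.exists_radius_step_estimate hlam (P := P) hf hxs hU (hsub (hxs x0)) hLip hco hb1
  set S := L1Newton.SStar f lam P.epsg with hS
  set ρ := (P.tau + 1) / (P.tau + 3 / 2) with hρdef
  have hρ0 : 0 < ρ := by positivity
  have hρ1 : ρ < 1 := by rw [hρdef, div_lt_one (by linarith)]; linarith
  have hρ' : 0 < 1 - ρ := by linarith
  -- `A` serves the rate `1 + delta` and `B` the linear rate; both arise from `kappa * dist ≤ ‖g^ε‖
  -- ≤ Lg * dist`, and neither depends on `b`.
  set A := C1 * Lg ^ (1 + P.delta) / kappa with hA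
  set B := Lg / kappa with hB
  have hA0 : 0 < A := by positivity
  have hB0 : 0 < B := by positivity
  refine ⟨A + B, by positivity, ρ, hρ0, hρ1, fun b hb => ?_⟩
  -- Since `‖g^ε(x K)‖ ≤ Lg * ‖x K - xs‖`, the whole trajectory stays within `q * ‖x K - xs‖` of
  -- `xs`.
  set q := 1 + Lg / (√P.epsg * (1 - ρ)) with hq
  have hq1 : 1 ≤ q := le_add_of_nonneg_right (by positivity)
  have hminRb : 0 < min R b := lt_min hR hb
  refine ⟨min R b / q, by positivity, fun x hx0 hgen hsign K hprox hxK => ?_⟩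
  have hstepk : ∀ k ≥ K, x k ∈ Metric.ball xs R → _ := fun k hk hxk =>
    hest (x k) hxk (x (k + 1)) (hprox k hk) (hprox (k + 1) (by omega)) (hgen k).2.1
      ((hgen k).2.2 (hprox k hk)) (hsign k (Metric.ball_subset_ball hRb hxk))
  rw [Metric.mem_ball, lt_div_iff₀ (by linarith), dist_eq_norm] at hxK
  have hxKR : x K ∈ Metric.ball xs R := by
    rw [Metric.mem_ball, dist_eq_norm]
    calc ‖x K - xs‖ ≤ ‖x K - xs‖ * q := le_mul_of_one_le_right (norm_nonneg _) hq1
      _ < R := hxK.trans_le (min_le_left _ _)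
  have hgK : ‖L1Newton.gEps f lam P.epsg (x K)‖ ≤ Lg * ‖x K - xs‖ := by
    refine (hstepk K le_rfl hxKR).1.trans ?_
    rw [← dist_eq_norm]
    gcongr
    exact Metric.infDist_le_dist_of_mem hxsS
  set Q := ‖x K - xs‖ + ‖L1Newton.gEps f lam P.epsg (x K)‖ / (√P.epsg * (1 - ρ)) with hQ
  have hQlt : Q < min R b := by
    refine lt_of_le_of_lt ?_ hxK
    calc Q ≤ ‖x K - xs‖ + Lg * ‖x K - xs‖ / (√P.epsg * (1 - ρ)) := by rw [hQ]; gcongr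
      _ = ‖x K - xs‖ * q := by rw [hq]; ring
  have htrap := L1Newton.geometric_trapping (u := fun m => x (K + m)) (p := xs)
    (g := fun m => ‖L1Newton.gEps f lam P.epsg (x (K + m))‖) he hρ0.le hρ1
    (fun m => norm_nonneg _) (fun m hm => by
      have h := hstepk (K + m) (by omega) (by rwa [Metric.mem_ball, dist_eq_norm])
      exact ⟨h.2.1, h.2.2.2⟩) (hQlt.trans_le (min_le_left R b))
  simp only [add_zero] at htrap
  have hball : ∀ m, x (K + m) ∈ Metric.ball xs R := fun m => by
    rw [Metric.mem_ball, dist_eq_norm]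
    exact (htrap m).1.trans_lt (hQlt.trans_le (min_le_left _ _))
  have herrk : ∀ m, kappa * Metric.infDist (x (K + m)) S ≤
      ‖L1Newton.gEps f lam P.epsg (x (K + m))‖ := fun m => by
    simpa only [Real.rpow_one] using herr _ (Metric.ball_subset_ball hRb (hball m))
  have hlin : ∀ m, Metric.infDist (x (K + m)) S ≤ B * ρ ^ m * Metric.infDist (x K) S :=
    fun m => by
    rw [hB, div_mul_eq_mul_div, div_mul_eq_mul_div, le_div_iff₀' hkappa]
    calc kappa * Metric.infDist (x (K + m)) S
        ≤ ρ ^ m * ‖L1Newton.gEps f lam P.epsg (x K)‖ := (herrk m).trans (htrap m).2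
      _ ≤ ρ ^ m * (Lg * Metric.infDist (x K) S) := by
        gcongr; exact (hstepk K le_rfl hxKR).1
      _ = _ := by ring
  have htend : Tendsto (fun m => Metric.infDist (x (K + m)) S) atTop (𝓝 0) := by
    refine squeeze_zero (fun m => Metric.infDist_nonneg) hlin ?_
    have h1 := tendsto_pow_atTop_nhds_zero_of_lt_one hρ0.le hρ1
    simpa using (h1.const_mul B).mul_const (Metric.infDist (x K) S)
  have hshift : ∀ {X : Type} (u : ℕ → X) (l : Filter X),
      Tendsto (fun m => u (K + m)) atTop l → Tendsto u atTop l := fun u l h =>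
    (tendsto_add_atTop_iff_nat K).1 (by simpa only [add_comm K] using h)
  refine ⟨⟨hshift _ _ htend, fun k hk => ?_, fun m => (hlin m).trans ?_⟩, ?_⟩
  · obtain ⟨m, rfl⟩ := Nat.exists_eq_add_of_le hk
    have h := hstepk _ hk (hball m)
    have hd := Metric.infDist_nonneg (x := x (K + m)) (s := S)
    have h1 : Metric.infDist (x (K + m + 1)) S ≤
        A * Metric.infDist (x (K + m)) S ^ (1 + P.delta) := by
      rw [hA, div_mul_eq_mul_div, le_div_iff₀' hkappa]
      calc kappa * Metric.infDist (x (K + m + 1)) S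
          ≤ C1 * ‖L1Newton.gEps f lam P.epsg (x (K + m))‖ ^ (1 + P.delta) :=
            (herrk (m + 1)).trans h.2.2.1
        _ ≤ C1 * (Lg * Metric.infDist (x (K + m)) S) ^ (1 + P.delta) := by
          gcongr; exact h.1
        _ = _ := by rw [Real.mul_rpow hLg.le hd, mul_assoc]
    refine h1.trans ?_
    gcongr
    linarith
  · have := Metric.infDist_nonneg (x := x K) (s := S)
    gcongr
    linarith
  · have hcauchy : CauchySeq fun m => x (K + m) := by
      refine cauchySeq_of_le_geometric ρ (‖L1Newton.gEps f lam P.epsg (x K)‖ / √P.epsg) hρ1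
        fun m => ?_
      rw [dist_comm, dist_eq_norm, div_mul_eq_mul_div, le_div_iff₀' he]
      refine ((hstepk (K + m) (by omega) (hball m)).2.1.trans (htrap m).2).trans_eq (mul_comm _ _)
    obtain ⟨xhat, hxhat⟩ := cauchySeq_tendsto_of_complete hcauchy
    have hdist : dist xhat xs ≤ Q :=
      le_of_tendsto (hxhat.dist tendsto_const_nhds) (Eventually.of_forall fun m => by
        rw [dist_eq_norm]; exact (htrap m).1)
    have hzero : Metric.infDist xhat S = 0 :=
      tendsto_nhds_unique (((Metric.continuous_infDist_pt S).tendsto xhat).comp hxhat) htend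
    -- Zero distance gives membership because the distance to `S*` is attained near `xs`; closedness
    -- of all of `S*` is not needed.
    obtain ⟨z, hz, hzd⟩ := hnear xhat
      (Metric.mem_ball.mpr (hdist.trans_lt (hQlt.trans_le (min_le_left _ _))))
    rw [hzero, eq_comm, dist_eq_zero] at hzd
    exact ⟨xhat, ⟨hzd ▸ hz,
      Metric.mem_ball.mpr (hdist.trans_lt (hQlt.trans_le (min_le_right _ _)))⟩,
      hshift _ _ hxhat⟩
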